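/- **Setting.** An independent cascade network is a finite directed graph $G=(V,E)$, $n=|V|$, $m=|E|$, with a probability $p_e\in[0,1]$ on every edge. Given a rumor seed set $S_r\subseteq V$ and a positive seed set $S_p\subseteq V$, the seeds are active at time $0$; a node activated at time $t-1$ makes at time $t$ one attempt to activate each inactive out-neighbour $v$ (edge $e=(u,v)$), which succeeds independently with probability $p_e$; a node takes the cascade that reaches it first, the rumor winning ties. Let $f(S_p)$ be the expected number of nodes that are not activated by the rumor and $OPT_i=\max_{|S|\le i}f(S)$. **Random R-tuple** $(V^*,E_t,E_f,B)$: choose $v\in V$ uniformly and search backwards from $v$ breadth first. If the current layer is empty, stop with $B=0$; if it contains a rumor seed, stop with $B=1$; otherwise add it to $V^*$ and test every edge $(u_2,u_1)$ with $u_1$ in the current layer and $u_2\notin V^*$ by flipping a coin with success probability $p_{(u_2,u_1)}$; the edge is put into $E_t$ or $E_f$ according to the outcome, and the tails of the successful edges form the next layer. For a set $S$ and a finite collection $R$ of R-tuples, let $F(S,R)$ be the number of R-tuples in $R$ with $B=0$ or $S\cap V^*\ne\emptyset$. **Node selection** on $(R,k)$ is the greedy algorithm for maximum coverage: it chooses $k$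 nodes one after the other, each contained in the largest number of sets $V^*$ that are not yet covered (R-tuples with $B=0$ count as covered by every node). It is implemented with buckets, the nodes being sorted by the number of uncovered sets containing them. **The RBR algorithm** with parameters $k$, $N,\delta_1,\delta_2,\delta_3$: 1. Estimation of $OPT_k$. Let $\lambda=n(2+\delta_3)\ln\bigl(N\binom nk\log_2 n\bigr)/\delta_3^2$. Start with $R=\emptyset$. For $i=1,\dots,\lfloor\log_2(n-1)\rfloor$: put $x_i=n/2^i$, $l_i=\lambda/x_i$, add random R-tuples to $R$ until $|R|>l_i$, let $S'$ be the result of node selection on $(R,k)$, and if $nF(S',R)/l_i\ge(1+\delta_3)x_i$, return $OPT_k^*=nF(S',R)/(l_i(1+\delta_3))$. If no round returns, $OPT_k^*=1$. 2. With $\delta=\delta_2-(1-1/e)\delta_1$ let $l^*=\max\left(\dfrac{2n\ln N}{\delta_1^2\,OPT_k^*},\ \dfrac{(2+\delta)\,n\ln\bigl(N\binom nk\bigr)}{\delta^2\,OPT_k^*}\right)$, generate $\lceil l^*\rceil$ fresh random R-tuples, and return the result of node selection on them. Running time is counted in elementary steps of a unit-cost random access machine (arithmetic operation, array access, coin flip,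 choice of a uniform node). **Theorem.** (a) For every network with $n\ge1$ and every $S_r$, the expected number $TIME$ of edges tested in generating one random R-tuple satisfies $TIME\le\frac mn\,OPT_1$. (b) For all $N>0$, $\delta_3>0$, $c>0$ there is a constant $C>0$, depending only on $N,\delta_3,c$, such that for every network with $m\ge n\ge2$, every $S_r\subseteq V$, every $1\le k\le n$, and all $\delta_1,\delta_2$ with $0<\delta_2\le1$, $\delta_1\ge c\,\delta_2$ and $\delta_2-(1-1/e)\delta_1\ge c\,\delta_2$, the expected running time of the RBR algorithm is at most $C\cdot\dfrac{k\,m\ln n}{\delta_2^2}$. -/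

import Mathlib

namespace RBR

noncomputable section

open scoped ENNReal

/-! ### Independent cascade networks and the objective function -/

/-- An independent cascade network on a finite node set: a directed graph given by its edge set,
with a propagation probability on every edge. -/
structure Network (V : Type) where
  edges : Finset (V × V)
  prob : V × V → unitInterval

variable {V : Type} [Fintype V] [DecidableEq V]

/-- The probability of the realization with live edge set `g` (every edge of the network is kept
independently with its propagation probability). -/
def prGraph (G : Network V) (g : Finset (V × V)) : ℝ :=
  (∏ e ∈ g, (G.prob e : ℝ)) * ∏ e ∈ G.edges \ g, (1 - (G.prob e : ℝ))

/-- State of the two-cascade diffusion: nodes activated so far by the rumor and by the positive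
cascade, and those activated at the current time step. -/
structure Cascade (V : Type) where
  rumor : Finset V
  positive : Finset V
  newRumor : Finset V
  newPositive : Finset V

/-- Time `0`: the seeds are active; the rumor has priority on common seeds. -/
def Cascade.init (Sr Sp : Finset V) : Cascade V :=
  ⟨Sr, Sp \ Sr, Sr, Sp \ Sr⟩

/-- One time step in a realization `g`: the nodes activated at the previous step activate their
inactive out-neighbours; the rumor has priority. -/
def Cascade.step (g : Finset (V × V)) (s : Cascade V) : Cascade V :=
  let inactive := Finset.univ \ (s.rumor ∪ s.positive)
  let r := inactive.filter fun v => ∃ u ∈ s.newRumor, (u, v) ∈ g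
  let q := (inactive \ r).filter fun v => ∃ u ∈ s.newPositive, (u, v) ∈ g
  ⟨s.rumor ∪ r, s.positive ∪ q, r, q⟩

/-- `u` is eventually activated by the rumor in the realization `g`. -/
def RumorActivated (g : Finset (V × V)) (Sr Sp : Finset V) (u : V) : Prop :=
  ∃ t : ℕ, u ∈ ((Cascade.step g)^[t] (Cascade.init Sr Sp)).rumor

open Classical in
/-- The expected number of nodes that are not activated by the rumor. -/
def f (G : Network V) (Sr Sp : Finset V) : ℝ :=
  ∑ g ∈ G.edges.powerset, ∑ u : V,
    prGraph G g * (if RumorActivated g Sr Sp u then 0 else 1)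

/-- The maximum of `f` over all seed sets with at most `i` nodes. -/
def OPT (G : Network V) (Sr : Finset V) (i : ℕ) : ℝ :=
  (Finset.univ.filter fun S : Finset V => S.card ≤ i).sup' ⟨∅, by simp⟩ (f G Sr)

/-! ### Randomized programs with a step counter

Cost conventions (unit-cost random access machine): an arithmetic operation or comparison, an array
or list access, a coin flip and the choice of a uniform node cost `O(1)`. Functions out of `V` or
`ℕ` play the role of arrays; membership of a node in a list or set of nodes is read off a mark
array. Every such bundle of `O(1)` operations is paid for by an explicit tick. -/

/-- A randomized program: the joint law of its output and of the number of steps it makes. -/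
def Prog (α : Type) : Type := PMF (α × ℕ)

instance : Monad Prog where
  pure a := PMF.pure (a, 0)
  bind x F := PMF.bind x fun y => PMF.map (fun z => (z.1, y.2 + z.2)) (F y.1)

/-- Make `c` steps. -/
def tick (c : ℕ) : Prog Unit := PMF.pure ((), c)

/-- A deterministic computation, given by its output and its number of steps. -/
def det {α : Type} (x : α × ℕ) : Prog α := PMF.pure x

/-- The law of a coin showing `true` with probability `p`. -/
def coinPMF (p : unitInterval) : PMF Bool :=
  PMF.ofFintype (fun b => ENNReal.ofReal (if b then (p : ℝ) else 1 - p)) (by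
    have h0 : (0 : ℝ) ≤ p := p.2.1
    have h1 : (0 : ℝ) ≤ 1 - p := sub_nonneg.2 p.2.2
    rw [Fintype.sum_bool]
    simp only [if_true, Bool.false_eq_true, if_false]
    rw [← ENNReal.ofReal_add h0 h1]
    simp)

/-- Flip a coin (one step). -/
def coin (p : unitInterval) : Prog Bool := PMF.map (fun b => (b, 1)) (coinPMF p)

/-- Choose a node uniformly at random (one step). -/
def uniformNode [Nonempty V] : Prog V :=
  PMF.map (fun v => (v, 1)) (PMF.uniformOfFintype V)

/-- Expectation of a function of the output. -/
def Prog.expect {α : Type} (x : Prog α) (h : α → ℕ) : ℝ≥0∞ :=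
  ∑' y : α × ℕ, (show PMF (α × ℕ) from x) y * (h y.1 : ℝ≥0∞)

/-- Expected number of steps. -/
def Prog.expectedTime {α : Type} (x : Prog α) : ℝ≥0∞ :=
  ∑' y : α × ℕ, (show PMF (α × ℕ) from x) y * (y.2 : ℝ≥0∞)

/-! ### Random R-tuples -/

/-- An R-tuple `(V*, E_t, E_f, B)`; `hit` is the bit `B`. -/
structure RTuple (V : Type) where
  verts : List V
  Et : List (V × V)
  Ef : List (V × V)
  hit : Bool

/-- Number of edges tested while the R-tuple was generated. -/
def RTuple.numTested (T : RTuple V) : ℕ := T.Et.length + T.Ef.length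

/-- Adjacency list of in-neighbours. -/
def inNbrs (G : Network V) (v : V) : List V :=
  (Finset.univ.filter fun w => (w, v) ∈ G.edges).toList

/-- Test the edges `(w, u)`, `w` in the given list, whose tail `w` is not in `visited`. The
accumulator holds the next layer, `E_t` and `E_f`. Every edge that is looked at costs a step, and
every edge that is tested costs another three: the coin flip, the update of the accumulator, and
the later removal of a possible mark of `w`. -/
def scanNode (G : Network V) (visited : List V) (u : V) :
    List V → List V × List (V × V) × List (V × V) →
      Prog (List V × List (V × V) × List (V × V))
  | [], acc => pure acc
  | w :: ws, (next, Et, Ef) => do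
      tick 1
      if w ∈ visited then
        scanNode G visited u ws (next, Et, Ef)
      else
        tick 2
        let b ← coin (G.prob (w, u))
        if b then
          scanNode G visited u ws (if w ∈ next then next else w :: next, (w, u) :: Et, Ef)
        else
          scanNode G visited u ws (next, Et, (w, u) :: Ef)

/-- Test the edges into the nodes of the current layer. -/
def scanLayer (G : Network V) (visited : List V) :
    List V → List V × List (V × V) × List (V × V) →
      Prog (List V × List (V × V) × List (V × V))
  | [], acc => pure acc
  | u :: us, acc => do
      tick 1
      let acc' ← scanNode G visited u (inNbrs G u) acc
      scanLayer G visited us acc'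

/-- Reverse breadth-first search. Each round but the last puts at least one new node into `V*`, so
the counter (initially one more than the number of nodes) never runs out. Per layer there is one
step, and for each node of the layer one step each for the comparison with the rumor seeds, for
moving it to `V*` (and marking it), and for the later removal of the mark. -/
def bfs (G : Network V) (Sr : Finset V) :
    ℕ → List V → List V → List (V × V) → List (V × V) → Prog (RTuple V)
  | 0, _, verts, Et, Ef => pure ⟨verts, Et, Ef, false⟩
  | fuel + 1, layer, verts, Et, Ef => do
      tick (1 + 3 * layer.length)
      if layer = [] then
        pure ⟨verts, Et, Ef, false⟩
      else if ∃ v ∈ layer, v ∈ Sr then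
        pure ⟨verts, Et, Ef, true⟩
      else
        let verts' := layer ++ verts
        let acc ← scanLayer G verts' layer ([], Et, Ef)
        bfs G Sr fuel acc.1 verts' acc.2.1 acc.2.2

/-- Random R-tuple of the node `v`. -/
def rTupleOf (G : Network V) (Sr : Finset V) (v : V) : Prog (RTuple V) :=
  bfs G Sr (Fintype.card V + 1) [v] [] [] []

/-- Random R-tuple. -/
def randomRTuple [Nonempty V] (G : Network V) (Sr : Finset V) : Prog (RTuple V) := do
  let v ← uniformNode
  rTupleOf G Sr v

/-- Put `j` further random R-tuples into the collection. -/
def generate [Nonempty V] (G : Network V) (Sr : Finset V) :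
    ℕ → List (RTuple V) → Prog (List (RTuple V))
  | 0, R => pure R
  | j + 1, R => do
      tick 1
      let T ← randomRTuple G Sr
      generate G Sr j (T :: R)

/-! ### Node selection: the greedy algorithm for maximum coverage

Deterministic computations return their result together with their number of steps. R-tuples with
`B = 0` are covered by every node, so only the sets `V*` of the others influence the choice. The
nodes are kept in buckets according to the number of uncovered sets that contain them; a node whose
count has dropped is moved to its right bucket only when it is met. -/

/-- For each node the list of the (indices of the) sets that contain it; two steps per occurrence
(the list and the counter), one per set. -/
def buildOcc : ℕ → List (List V) → (V → List ℕ) → (V → List ℕ) × ℕ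
  | _, [], occ => (occ, 0)
  | i, s :: ss, occ =>
      let r := buildOcc (i + 1) ss
        (s.foldl (fun o v => Function.update o v (i :: o v)) occ)
      (r.1, r.2 + 2 * s.length + 1)

/-- Mark the listed sets as covered, and lower the counts of the members of those that were not
covered before: one step per listed set, and one per member of a newly covered set. -/
def coverSets (sets : List (List V)) :
    List ℕ → (V → ℕ) → (ℕ → Bool) → ((V → ℕ) × (ℕ → Bool)) × ℕ
  | [], cnt, cov => ((cnt, cov), 0)
  | i :: is, cnt, cov =>
      if cov i then
        let r := coverSets sets is cnt cov
        (r.1, r.2 + 1)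
      else
        let s := sets.getD i []
        let r := coverSets sets is
          (s.foldl (fun c w => Function.update c w (c w - 1)) cnt) (Function.update cov i true)
        (r.1, r.2 + 1 + s.length)

/-- Main loop: `k` nodes are still to be chosen, and the buckets above `c` are empty. The first
argument only bounds the number of rounds. -/
def selectLoop (sets : List (List V)) (occ : V → List ℕ) :
    ℕ → ℕ → ℕ → (V → ℕ) → (ℕ → Bool) → (ℕ → List V) → List V → List V × ℕ
  | 0, _, _, _, _, _, sel => (sel, 0)
  | _ + 1, 0, _, _, _, _, sel => (sel, 1)
  | fuel + 1, k + 1, c, cnt, cov, bucket, sel =>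
      match bucket c with
      | [] =>
          if c = 0 then (sel, 1)
          else
            let r := selectLoop sets occ fuel (k + 1) (c - 1) cnt cov bucket sel
            (r.1, r.2 + 1)
      | v :: vs =>
          if cnt v = c then
            let d := coverSets sets (occ v) cnt cov
            let r := selectLoop sets occ fuel k c d.1.1 d.1.2
              (Function.update bucket c vs) (v :: sel)
            (r.1, r.2 + d.2 + 1)
          else
            let r := selectLoop sets occ fuel (k + 1) c cnt cov
              (Function.update (Function.update bucket c vs) (cnt v) (v :: bucket (cnt v))) sel
            (r.1, r.2 + 1)

/-- Greedy choice of `k` nodes from the list `nodes` of all nodes. Each round of the main loop ends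
it, chooses a node, lowers the current bucket number, or moves a node to a strictly lower bucket;
hence, if `k` is at most the number of nodes, the bound on the number of rounds is never reached.
The extra summand of the step count pays for reading the R-tuples and setting up the arrays. -/
def nodeSelection (nodes : List V) (R : List (RTuple V)) (k : ℕ) : List V × ℕ :=
  let sets := (R.filter fun T => T.hit).map fun T => T.verts
  let o := buildOcc 0 sets fun _ => []
  let cnt : V → ℕ := fun v => (o.1 v).length
  let bucket : ℕ → List V :=
    nodes.foldl (fun b v => Function.update b (cnt v) (v :: b (cnt v))) fun _ => []
  let r := selectLoop sets o.1 ((sets.length + 1) * (nodes.length + 1)) k sets.length cnt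
    (fun _ => false) bucket []
  (r.1, r.2 + o.2 + (2 * nodes.length + 2 * R.length + 1))

/-- `F(S, R)`: the number of R-tuples in `R` with `B = 0` or `S ∩ V* ≠ ∅`. -/
def coverage (S : List V) (R : List (RTuple V)) : ℕ × ℕ :=
  (R.countP fun T => !T.hit || T.verts.any fun v => decide (v ∈ S),
    2 * S.length + (R.map fun T => T.verts.length + 1).sum)

/-! ### The whole algorithm -/

/-- `λ₃ = n (2 + δ) ln (N · C(n,k) · log₂ n) / δ²`. -/
def lam (n k : ℕ) (N δ : ℝ) : ℝ :=
  n * (2 + δ) * Real.log (N * (n.choose k : ℝ) * Real.logb 2 n) / δ ^ 2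

/-- Rounds `i, i + 1, …` (`rounds` many) of the estimation of `OPT_k`, where `R` is the collection
of R-tuples generated so far. R-tuples are added until there are more than `l_i`. If no round
succeeds, the estimate is `1`, the trivial lower bound of `OPT_k`. -/
def estimateLoop [Nonempty V] (G : Network V) (Sr : Finset V) (k : ℕ) (N δ : ℝ) :
    ℕ → ℕ → List (RTuple V) → Prog ℝ
  | 0, _, _ => pure 1
  | rounds + 1, i, R => do
      let n := Fintype.card V
      let x : ℝ := n / 2 ^ i
      let l : ℝ := lam n k N δ / x
      tick 1
      let R' ← generate G Sr (⌊l + 1⌋₊ - R.length) R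
      let S ← det (nodeSelection Finset.univ.toList R' k)
      let F ← det (coverage S R')
      if (1 + δ) * x ≤ n * F / l then
        pure (n * F / (l * (1 + δ)))
      else
        estimateLoop G Sr k N δ rounds (i + 1) R'

/-- Estimation of `OPT_k`, with rounds `i = 1, …, ⌊log₂ (n - 1)⌋`; the binomial coefficient in `λ₃`
is computed in `k` steps. -/
def estimateOPT [Nonempty V] (G : Network V) (Sr : Finset V) (k : ℕ) (N δ : ℝ) : Prog ℝ := do
  tick (k + 1)
  estimateLoop G Sr k N δ (Nat.log 2 (Fintype.card V - 1)) 1 []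

/-- The number `l*` of R-tuples of the second phase, as a function of the estimate of `OPT_k`. -/
def lStar (n k : ℕ) (N δ₁ δ₂ optEst : ℝ) : ℝ :=
  let δ := δ₂ - (1 - Real.exp (-1)) * δ₁
  max (2 * n * Real.log N / (δ₁ ^ 2 * optEst))
    ((2 + δ) * n * Real.log (N * (n.choose k : ℝ)) / (δ ^ 2 * optEst))

/-- The R-tuple based randomized rumor blocking algorithm. The first step count pays for reading
the network and setting up its adjacency lists and the mark array. -/
def rbr [Nonempty V] (G : Network V) (Sr : Finset V) (k : ℕ) (N δ₁ δ₂ δ₃ : ℝ) :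
    Prog (List V) := do
  tick (Fintype.card V + G.edges.card)
  let optEst ← estimateOPT G Sr k N δ₃
  tick (k + 1)
  let R ← generate G Sr ⌈lStar (Fintype.card V) k N δ₁ δ₂ optEst⌉₊ []
  det (nodeSelection Finset.univ.toList R k)

end

end RBR

namespace RBR

open scoped ENNReal

section

/-! ### Expectations over the runs of a randomized program -/

/-! Part (a). Flipping the coins during the search gives the pair (V*, B) the same law as searching
a realization drawn in advance (`bfs_mean`). There V* is a ball of nodes with short live paths to
the root v, and it contains no rumor seed (`bfsSet_spec`). If u lies in V*, a positive seed at u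
protects v (`not_rumorActivated`), so P(u ∈ V*) ≤ f({u})/n ≤ OPT_1/n (`prob_mem_verts_le`). Every
tested edge enters a node of V*. Summing in-degrees gives (m/n) OPT_1.

Part (b). Generating, selecting and counting take time linear in n plus the total size of the
R-tuples (`bfs_always`, `nodeSelection_cost`). By the argument of (a), the mean size of an R-tuple
is at most 3(m/n)O, where O = max(OPT_1, 1) (`meanSize_le`). It remains to control how many R-tuples
are generated.

Round i of the estimation has about λ2^i/n R-tuples, and it fails only if greedy covers fewer than
(1+δ_3)λ/n of them. Already the first greedy choice covers as many as the best single node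
(`nodeSelection_coverage`), and some single node covers a random R-tuple with probability at least
OPT_1/n. A Chernoff bound with the weight 2^(-number covered) makes failure exponentially unlikely
once z_i = O·2^(i+1)/n is large (`failInd_mean_le`). Hence the sum of P(round i fails)·z_i is
bounded by a constant depending only on N and δ_3 (`sum_failBound_le`).

This one sum serves twice. Round i+1 is reached only after round i failed, and its cost is of order
(m/n)λz_i apart from lower-order terms, so the estimation costs O(k m ln n). An estimate returned in
round i+1 is at least n/2^(i+1), so E[1/OPT*] is at most a constant over O
(`estimateLoop_mean_inv_le`). In the second phase this factor 1/O cancels the O in the mean size.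
Only OPT_1 enters the argument, never OPT_k.

A round also processes R-tuples from earlier rounds, whose sizes are correlated with the failures.
The weight resolves this: tilting by a factor between 1/2 and 1 at most doubles the mean size
(`generate_mean_weight_le`). -/

/-- The law of output and step count of a randomized program. -/
def Prog.law {α : Type} (x : Prog α) : PMF (α × ℕ) := x

/-- Expectation of a function of output and step count. -/
noncomputable def Prog.mean {α : Type} (x : Prog α) (h : α × ℕ → ℝ≥0∞) : ℝ≥0∞ :=
  ∑' y, x.law y * h y

/-- The predicate holds for all possible runs of the program. -/
def Prog.Always {α : Type} (x : Prog α) (P : α × ℕ → Prop) : Prop :=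
  ∀ y, x.law y ≠ 0 → P y

theorem tsum_pmf_bind_mul {α β : Type} (p : PMF α) (F : α → PMF β) (h : β → ℝ≥0∞) :
    ∑' b, (p.bind F) b * h b = ∑' a, p a * ∑' b, F a b * h b := by
  simp only [PMF.bind_apply, ← ENNReal.tsum_mul_right, ← ENNReal.tsum_mul_left]
  rw [ENNReal.tsum_comm]
  simp only [mul_assoc]

theorem tsum_pmf_pure_mul {α : Type} (a : α) (h : α → ℝ≥0∞) :
    ∑' b, (PMF.pure a) b * h b = h a := by
  rw [tsum_eq_single a]
  · simp
  · intro b hb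
    simp [PMF.pure_apply, hb]

theorem tsum_pmf_map_mul {α β : Type} (p : PMF α) (g : α → β) (h : β → ℝ≥0∞) :
    ∑' b, (PMF.map g p) b * h b = ∑' a, p a * h (g a) := by
  rw [← PMF.bind_pure_comp, tsum_pmf_bind_mul]
  simp only [Function.comp, tsum_pmf_pure_mul]

namespace Prog

variable {α β : Type}

theorem mean_pure (a : α) (h : α × ℕ → ℝ≥0∞) : (pure a : Prog α).mean h = h (a, 0) :=
  tsum_pmf_pure_mul _ _

theorem mean_tick (c : ℕ) (h : Unit × ℕ → ℝ≥0∞) : (tick c).mean h = h ((), c) :=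
  tsum_pmf_pure_mul _ _

theorem mean_det (a : α × ℕ) (h : α × ℕ → ℝ≥0∞) : (det a).mean h = h a :=
  tsum_pmf_pure_mul _ _

theorem mean_bind (x : Prog α) (F : α → Prog β) (h : β × ℕ → ℝ≥0∞) :
    (x >>= F).mean h = x.mean fun y => (F y.1).mean fun z => h (z.1, y.2 + z.2) := by
  refine (tsum_pmf_bind_mul _ _ _).trans ?_
  refine tsum_congr fun y => ?_
  congr 1
  exact tsum_pmf_map_mul _ _ _

theorem mean_coin (p : unitInterval) (h : Bool × ℕ → ℝ≥0∞) :
    (coin p).mean h = ENNReal.ofReal p * h (true, 1) + ENNReal.ofReal (1 - p) * h (false, 1) := by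
  refine (tsum_pmf_map_mul _ _ _).trans ?_
  rw [tsum_fintype, Fintype.sum_bool]
  simp [coinPMF]

theorem mean_uniformNode {V : Type} [Fintype V] [Nonempty V] (h : V × ℕ → ℝ≥0∞) :
    (uniformNode (V := V)).mean h = (Fintype.card V : ℝ≥0∞)⁻¹ * ∑ v, h (v, 1) := by
  refine (tsum_pmf_map_mul _ _ _).trans ?_
  rw [tsum_fintype, Finset.mul_sum]
  simp

theorem mean_add (x : Prog α) (h h' : α × ℕ → ℝ≥0∞) :
    (x.mean fun y => h y + h' y) = x.mean h + x.mean h' := by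
  simp only [mean, mul_add, ENNReal.tsum_add]

theorem mean_sum {ι : Type} (s : Finset ι) (x : Prog α) (h : ι → α × ℕ → ℝ≥0∞) :
    (x.mean fun y => ∑ i ∈ s, h i y) = ∑ i ∈ s, x.mean (h i) := by
  simp only [mean, Finset.mul_sum]
  exact Summable.tsum_finsetSum fun i _ => ENNReal.summable

theorem mean_const_mul (x : Prog α) (c : ℝ≥0∞) (h : α × ℕ → ℝ≥0∞) :
    (x.mean fun y => c * h y) = c * x.mean h := by
  simp only [mean, ← ENNReal.tsum_mul_left]
  exact tsum_congr fun y => by ring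

theorem mean_mul_const (x : Prog α) (c : ℝ≥0∞) (h : α × ℕ → ℝ≥0∞) :
    (x.mean fun y => h y * c) = x.mean h * c := by
  simp only [mul_comm _ c, mean_const_mul]

theorem mean_const (x : Prog α) (c : ℝ≥0∞) : (x.mean fun _ => c) = c := by
  simp only [mean, ENNReal.tsum_mul_right, PMF.tsum_coe, one_mul]

/-- The comparison is needed only on runs of positive probability. This lets structural facts such
as the absence of repetitions in V* enter the estimates of expectations. -/
theorem mean_mono {x : Prog α} {h h' : α × ℕ → ℝ≥0∞} (H : x.Always fun y => h y ≤ h' y) :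
    x.mean h ≤ x.mean h' := by
  refine ENNReal.tsum_le_tsum fun y => ?_
  by_cases hy : x.law y = 0
  · simp [hy]
  · gcongr
    exact H y hy

theorem mean_congr {x : Prog α} {h h' : α × ℕ → ℝ≥0∞} (H : x.Always fun y => h y = h' y) :
    x.mean h = x.mean h' :=
  le_antisymm (mean_mono fun y hy => (H y hy).le) (mean_mono fun y hy => (H y hy).ge)

theorem always_of_forall {x : Prog α} {P : α × ℕ → Prop} (H : ∀ y, P y) : x.Always P :=
  fun y _ => H y

theorem Always.mono {x : Prog α} {P Q : α × ℕ → Prop} (hx : x.Always P) (H : ∀ y, P y → Q y) :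
    x.Always Q := fun y hy => H y (hx y hy)

theorem always_pure {a : α} {P : α × ℕ → Prop} (H : P (a, 0)) : (pure a : Prog α).Always P := by
  intro y hy
  have : y ∈ (PMF.pure (a, 0)).support := hy
  rw [PMF.support_pure] at this
  rw [Set.mem_singleton_iff.1 this]
  exact H

theorem always_det {a : α × ℕ} {P : α × ℕ → Prop} (H : P a) : (det a).Always P := by
  intro y hy
  have : y ∈ (PMF.pure a).support := hy
  rw [PMF.support_pure] at this
  rw [Set.mem_singleton_iff.1 this]
  exact H

theorem always_tick {c : ℕ} {P : Unit × ℕ → Prop} (H : P ((), c)) : (tick c).Always P :=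
  always_det H

theorem always_bind {x : Prog α} {F : α → Prog β} {P : β × ℕ → Prop}
    (H : x.Always fun y => (F y.1).Always fun z => P (z.1, y.2 + z.2)) : (x >>= F).Always P := by
  intro b hb
  have : b ∈ (PMF.bind x.law fun y => PMF.map (fun z => (z.1, y.2 + z.2)) (F y.1).law).support := hb
  rw [PMF.mem_support_bind_iff] at this
  obtain ⟨y, hy, hb⟩ := this
  rw [PMF.support_map] at hb
  obtain ⟨z, hz, rfl⟩ := hb
  exact H y hy z hz

theorem always_tick_bind {c : ℕ} {F : Unit → Prog β} {P : β × ℕ → Prop}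
    (H : (F ()).Always fun z => P (z.1, c + z.2)) : (tick c >>= F).Always P :=
  always_bind (always_tick H)

theorem always_det_bind {a : α × ℕ} {F : α → Prog β} {P : β × ℕ → Prop}
    (H : (F a.1).Always fun z => P (z.1, a.2 + z.2)) : (det a >>= F).Always P :=
  always_bind (always_det H)

theorem always_coin {p : unitInterval} {P : Bool × ℕ → Prop} (H : ∀ b, P (b, 1)) :
    (coin p).Always P := by
  intro y hy
  have : y ∈ (PMF.map (fun b => (b, 1)) (coinPMF p)).support := hy
  rw [PMF.support_map] at this
  obtain ⟨b, -, rfl⟩ := this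
  exact H b

theorem always_uniformNode {V : Type} [Fintype V] [Nonempty V] {P : V × ℕ → Prop}
    (H : ∀ v, P (v, 1)) : (uniformNode (V := V)).Always P := by
  intro y hy
  have : y ∈ (PMF.map (fun v => (v, 1)) (PMF.uniformOfFintype V)).support := hy
  rw [PMF.support_map] at this
  obtain ⟨b, -, rfl⟩ := this
  exact H b

theorem expect_eq_mean (x : Prog α) (h : α → ℕ) : x.expect h = x.mean fun y => (h y.1 : ℝ≥0∞) := rfl

theorem expectedTime_eq_mean (x : Prog α) : x.expectedTime = x.mean fun y => (y.2 : ℝ≥0∞) := rfl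

theorem expectedTime_bind (x : Prog α) (F : α → Prog β) :
    (x >>= F).expectedTime = x.mean fun y => (y.2 : ℝ≥0∞) + (F y.1).expectedTime := by
  simp only [expectedTime_eq_mean, mean_bind, Nat.cast_add, mean_add, mean_const]

theorem expectedTime_tick_bind (c : ℕ) (F : Unit → Prog β) :
    (tick c >>= F).expectedTime = c + (F ()).expectedTime := by
  rw [expectedTime_bind, mean_tick]

theorem expectedTime_det_bind (a : α × ℕ) (F : α → Prog β) :
    (det a >>= F).expectedTime = a.2 + (F a.1).expectedTime := by
  rw [expectedTime_bind, mean_det]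

theorem expectedTime_pure (a : α) : (pure a : Prog α).expectedTime = 0 := by
  rw [expectedTime_eq_mean, mean_pure]; simp

theorem expectedTime_det (a : α × ℕ) : (det a).expectedTime = a.2 := by
  rw [expectedTime_eq_mean, mean_det]

end Prog

end

section

variable {V : Type} [DecidableEq V]

/-! ### Deterministic bounds for the reverse breadth-first search -/

theorem scanNode_always (G : Network V) (visited : List V) (u : V) (ws : List V) :
    ∀ (next : List V) (Et Ef : List (V × V)), next.Nodup → (∀ w ∈ next, w ∉ visited) →
      (scanNode G visited u ws (next, Et, Ef)).Always fun y =>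
        y.1.1.Nodup ∧ (∀ w ∈ y.1.1, w ∉ visited) ∧ y.2 ≤ 4 * ws.length ∧
        y.1.1.length ≤ next.length + ws.length ∧
        y.1.2.1.length + y.1.2.2.length ≤ Et.length + Ef.length + ws.length := by
  induction ws with
  | nil =>
    intro next Et Ef hn hv
    rw [scanNode]
    exact Prog.always_pure ⟨hn, hv, by simp, by simp, by simp⟩
  | cons w ws ih =>
    intro next Et Ef hn hv
    rw [scanNode]
    refine Prog.always_tick_bind ?_
    by_cases hw : w ∈ visited
    · rw [if_pos hw]
      refine (ih next Et Ef hn hv).mono ?_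
      rintro y ⟨h1, h2, h3, h4, h5⟩
      simp only [List.length_cons]
      exact ⟨h1, h2, by omega, by omega, by omega⟩
    · rw [if_neg hw]
      refine Prog.always_tick_bind (Prog.always_bind (Prog.always_coin fun b => ?_))
      cases b
      · simp only [Bool.false_eq_true, if_false]
        refine (ih next Et ((w, u) :: Ef) hn hv).mono ?_
        rintro y ⟨h1, h2, h3, h4, h5⟩
        simp only [List.length_cons] at *
        exact ⟨h1, h2, by omega, by omega, by omega⟩
      · simp only [if_true]
        have hl : (if w ∈ next then next else w :: next).length ≤ next.length + 1 := by
          split_ifs <;> simp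
        refine (ih (if w ∈ next then next else w :: next) ((w, u) :: Et) Ef ?_ ?_).mono ?_
        · split_ifs with h
          · exact hn
          · exact List.nodup_cons.2 ⟨h, hn⟩
        · split_ifs with h
          · exact hv
          · intro x hx
            rcases List.mem_cons.1 hx with rfl | hx
            · exact hw
            · exact hv x hx
        · rintro y ⟨h1, h2, h3, h4, h5⟩
          simp only [List.length_cons] at *
          exact ⟨h1, h2, by omega, by omega, by omega⟩

variable [Fintype V]

/-- The number of edges into the listed nodes. -/
noncomputable def inDegSum (G : Network V) (us : List V) : ℕ :=
  (us.map fun u => (inNbrs G u).length).sum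

@[simp] theorem inDegSum_nil (G : Network V) : inDegSum G [] = 0 := rfl

@[simp] theorem inDegSum_cons (G : Network V) (u : V) (us : List V) :
    inDegSum G (u :: us) = (inNbrs G u).length + inDegSum G us := rfl

@[simp] theorem inDegSum_append (G : Network V) (us vs : List V) :
    inDegSum G (us ++ vs) = inDegSum G us + inDegSum G vs := by
  simp [inDegSum]

theorem scanLayer_always (G : Network V) (visited : List V) (us : List V) :
    ∀ (next : List V) (Et Ef : List (V × V)), next.Nodup → (∀ w ∈ next, w ∉ visited) →
      (scanLayer G visited us (next, Et, Ef)).Always fun y =>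
        y.1.1.Nodup ∧ (∀ w ∈ y.1.1, w ∉ visited) ∧ y.2 ≤ us.length + 4 * inDegSum G us ∧
        y.1.1.length ≤ next.length + inDegSum G us ∧
        y.1.2.1.length + y.1.2.2.length ≤ Et.length + Ef.length + inDegSum G us := by
  induction us with
  | nil =>
    intro next Et Ef hn hv
    rw [scanLayer]
    exact Prog.always_pure ⟨hn, hv, by simp, by simp, by simp⟩
  | cons u us ih =>
    intro next Et Ef hn hv
    rw [scanLayer]
    refine Prog.always_tick_bind (Prog.always_bind ?_)
    refine (scanNode_always G visited u _ next Et Ef hn hv).mono ?_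
    rintro ⟨⟨next', Et', Ef'⟩, t⟩ ⟨h1, h2, h3, h4, h5⟩
    refine (ih next' Et' Ef' h1 h2).mono ?_
    rintro y ⟨g1, g2, g3, g4, g5⟩
    simp only [List.length_cons, inDegSum_cons] at *
    exact ⟨g1, g2, by omega, by omega, by omega⟩

/-- A potential argument in which 1 + 3·|layer| is the cost already due for the pending layer. An
edge into V* pays 7: 4 for its scan and 3 for the node it may add to the next layer. A node of V*
pays 2: its step in `scanLayer` and a share of the constant step of the next round. -/
theorem bfs_always (G : Network V) (Sr : Finset V) (fuel : ℕ) :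
    ∀ (layer verts : List V) (Et Ef : List (V × V)), layer.Nodup → verts.Nodup →
      (∀ w ∈ layer, w ∉ verts) →
      (bfs G Sr fuel layer verts Et Ef).Always fun y =>
        y.1.verts.Nodup ∧
        y.2 + 2 * verts.length + 7 * inDegSum G verts ≤
          1 + 3 * layer.length + 2 * y.1.verts.length + 7 * inDegSum G y.1.verts ∧
        y.1.numTested + inDegSum G verts ≤ Et.length + Ef.length + inDegSum G y.1.verts := by
  induction fuel with
  | zero =>
    intro layer verts Et Ef hl hv hd
    rw [bfs]
    exact Prog.always_pure ⟨hv, by simp, by simp [RTuple.numTested]⟩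
  | succ fuel ih =>
    intro layer verts Et Ef hl hv hd
    rw [bfs]
    refine Prog.always_tick_bind ?_
    split_ifs with h0 h1
    · exact Prog.always_pure ⟨hv, by simp, by simp [RTuple.numTested]⟩
    · exact Prog.always_pure ⟨hv, by simp, by simp [RTuple.numTested]⟩
    · refine Prog.always_bind ?_
      refine (scanLayer_always G (layer ++ verts) layer [] Et Ef List.nodup_nil (by simp)).mono ?_
      rintro ⟨⟨next', Et', Ef'⟩, t⟩ ⟨g1, g2, g3, g4, g5⟩
      have hnd : (layer ++ verts).Nodup := List.nodup_append'.2 ⟨hl, hv, fun w h h' => hd w h h'⟩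
      refine (ih next' (layer ++ verts) Et' Ef' g1 hnd g2).mono ?_
      rintro y ⟨k1, k2, k3⟩
      -- The constant step of the next round is charged to a node of this layer, so the layer must
      -- be nonempty.
      have hpos : 1 ≤ layer.length := List.length_pos_of_ne_nil h0
      simp only [List.length_append, inDegSum_append, List.length_nil] at *
      exact ⟨k1, by omega, by omega⟩

/-- One more than the number of nodes in `V*` and of edges into them. -/
noncomputable def RTuple.size (G : Network V) (T : RTuple V) : ℕ :=
  1 + T.verts.length + inDegSum G T.verts

theorem randomRTuple_always [Nonempty V] (G : Network V) (Sr : Finset V) :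
    (randomRTuple G Sr).Always fun y =>
      y.1.verts.Nodup ∧ y.2 ≤ 7 * y.1.size G ∧ y.1.numTested ≤ inDegSum G y.1.verts := by
  refine Prog.always_bind (Prog.always_uniformNode fun v => ?_)
  refine (bfs_always G Sr _ [v] [] [] [] (by simp) (by simp) (by simp)).mono ?_
  rintro y ⟨k1, k2, k3⟩
  simp only [List.length_nil, List.length_singleton, inDegSum_nil, RTuple.size] at *
  exact ⟨k1, by omega, by omega⟩

end

section

variable {V : Type} [DecidableEq V]

/-! ### Deferred decisions: the search in a realization drawn in advance -/

/-- Expectation over the realizations of the network. -/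
noncomputable def realMean (G : Network V) (Φ : Finset (V × V) → ℝ≥0∞) : ℝ≥0∞ :=
  ∑ g ∈ G.edges.powerset, ENNReal.ofReal (prGraph G g) * Φ g

theorem prGraph_nonneg (G : Network V) (g : Finset (V × V)) : 0 ≤ prGraph G g :=
  mul_nonneg (Finset.prod_nonneg fun e _ => (G.prob e).2.1)
    (Finset.prod_nonneg fun e _ => sub_nonneg.2 (G.prob e).2.2)

theorem realMean_const (G : Network V) (c : ℝ≥0∞) : realMean G (fun _ => c) = c := by
  rw [realMean, ← Finset.sum_mul, ← ENNReal.ofReal_sum_of_nonneg fun g _ => prGraph_nonneg G g]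
  have : ∑ g ∈ G.edges.powerset, prGraph G g = 1 := by
    simp only [prGraph]
    rw [← Finset.prod_add]
    simp
  rw [this]; simp

theorem realMean_congr {G : Network V} {Φ Ψ : Finset (V × V) → ℝ≥0∞}
    (h : ∀ g ⊆ G.edges, Φ g = Ψ g) : realMean G Φ = realMean G Ψ :=
  Finset.sum_congr rfl fun g hg => by rw [h g (Finset.mem_powerset.1 hg)]

theorem realMean_mono {G : Network V} {Φ Ψ : Finset (V × V) → ℝ≥0∞}
    (h : ∀ g ⊆ G.edges, Φ g ≤ Ψ g) : realMean G Φ ≤ realMean G Ψ :=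
  Finset.sum_le_sum fun g hg => by gcongr; exact h g (Finset.mem_powerset.1 hg)

theorem prGraph_of_notMem {G : Network V} {e : V × V} (he : e ∈ G.edges) {g : Finset (V × V)}
    (hg : e ∉ g) :
    prGraph G g = (1 - G.prob e) *
      ((∏ e ∈ g, (G.prob e : ℝ)) * ∏ e ∈ G.edges.erase e \ g, (1 - (G.prob e : ℝ))) := by
  have : G.edges \ g = insert e (G.edges.erase e \ g) := by
    ext x; by_cases hx : x = e <;> simp_all
  rw [prGraph, this, Finset.prod_insert (by simp)]
  ring

theorem prGraph_insert {G : Network V} {e : V × V} {g : Finset (V × V)}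
    (hg : e ∉ g) :
    prGraph G (insert e g) = G.prob e *
      ((∏ e ∈ g, (G.prob e : ℝ)) * ∏ e ∈ G.edges.erase e \ g, (1 - (G.prob e : ℝ))) := by
  have : G.edges \ insert e g = G.edges.erase e \ g := by
    ext x; by_cases hx : x = e <;> simp_all
  rw [prGraph, this, Finset.prod_insert hg]
  ring

/-- Conditioning on the state of one edge. Since `Φ b` ignores that edge, it sees the same
distribution after the edge has been revealed. -/
theorem realMean_reveal {G : Network V} {e : V × V} (he : e ∈ G.edges)
    (Φ : Bool → Finset (V × V) → ℝ≥0∞) (hΦ : ∀ b g, Φ b (insert e g) = Φ b g) :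
    realMean G (fun g => Φ (decide (e ∈ g)) g) =
      ENNReal.ofReal (G.prob e) * realMean G (Φ true) +
        ENNReal.ofReal (1 - G.prob e) * realMean G (Φ false) := by
  have split : ∀ F : Finset (V × V) → ℝ≥0∞, realMean G F =
      ∑ g ∈ (G.edges.erase e).powerset,
        ENNReal.ofReal ((∏ e ∈ g, (G.prob e : ℝ)) * ∏ e ∈ G.edges.erase e \ g,
          (1 - (G.prob e : ℝ))) * (ENNReal.ofReal (1 - G.prob e) * F g +
          ENNReal.ofReal (G.prob e) * F (insert e g)) := by
    intro F
    rw [realMean, ← Finset.insert_erase he, Finset.sum_powerset_insert (by simp),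
      ← Finset.sum_add_distrib]
    simp only [Finset.insert_erase he]
    refine Finset.sum_congr rfl fun g hg => ?_
    have hg' : e ∉ g := fun h => by simpa using Finset.mem_powerset.1 hg h
    rw [prGraph_of_notMem he hg', prGraph_insert hg',
      ENNReal.ofReal_mul (sub_nonneg.2 (G.prob e).2.2), ENNReal.ofReal_mul (G.prob e).2.1]
    ring
  have hp : ENNReal.ofReal (1 - G.prob e) + ENNReal.ofReal (G.prob e) = 1 := by
    rw [← ENNReal.ofReal_add (sub_nonneg.2 (G.prob e).2.2) (G.prob e).2.1]
    simp
  have same : ∀ b, realMean G (Φ b) =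
      ∑ g ∈ (G.edges.erase e).powerset,
        ENNReal.ofReal ((∏ e ∈ g, (G.prob e : ℝ)) * ∏ e ∈ G.edges.erase e \ g,
          (1 - (G.prob e : ℝ))) * Φ b g := by
    intro b
    rw [split]
    refine Finset.sum_congr rfl fun g _ => ?_
    rw [hΦ, ← add_mul, hp, one_mul]
  rw [same, same, split, Finset.mul_sum, Finset.mul_sum, ← Finset.sum_add_distrib]
  refine Finset.sum_congr rfl fun g hg => ?_
  have hg' : e ∉ g := fun h => by simpa using Finset.mem_powerset.1 hg h
  simp only [hg', decide_false, Finset.mem_insert_self, decide_true, hΦ]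
  ring

/-- `Φ` stands for the rest of the search, run in a realization. As long as it ignores the edges
tested here, a fresh coin for each of them can be replaced by its state in the realization, one edge
at a time by `realMean_reveal`. -/
theorem scanNode_mean (G : Network V) (visited : List V) (u : V) (ws : List V)
    (Φ : Finset V → Finset (V × V) → ℝ≥0∞) (hws : ws.Nodup) (hG : ∀ w ∈ ws, (w, u) ∈ G.edges)
    (hΦ : ∀ X, ∀ w ∈ ws, ∀ g, Φ X (insert (w, u) g) = Φ X g) :
    ∀ (next : List V) (Et Ef : List (V × V)),
      ((scanNode G visited u ws (next, Et, Ef)).mean fun y => realMean G (Φ y.1.1.toFinset)) =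
        realMean G fun g =>
          Φ (next.toFinset ∪ ws.toFinset.filter fun w => w ∉ visited ∧ (w, u) ∈ g) g := by
  induction ws with
  | nil =>
    intro next Et Ef
    rw [scanNode, Prog.mean_pure]
    simp
  | cons w ws ih =>
    intro next Et Ef
    obtain ⟨hw, hnd⟩ := List.nodup_cons.1 hws
    have ih' := ih hnd (fun x hx => hG x (List.mem_cons_of_mem _ hx))
      fun X x hx => hΦ X x (List.mem_cons_of_mem _ hx)
    rw [scanNode, Prog.mean_bind, Prog.mean_tick]
    by_cases hv : w ∈ visited
    · simp only [if_pos hv]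
      rw [ih']
      refine realMean_congr fun g _ => ?_
      congr 2
      ext x
      simp only [Finset.mem_filter, List.mem_toFinset, List.mem_cons]
      constructor
      · rintro ⟨h1, h2⟩; exact ⟨Or.inr h1, h2⟩
      · rintro ⟨rfl | h1, h2, h3⟩
        · exact absurd hv h2
        · exact ⟨h1, h2, h3⟩
    · simp only [if_neg hv]
      rw [Prog.mean_bind, Prog.mean_tick, Prog.mean_bind, Prog.mean_coin]
      simp only [if_true, Bool.false_eq_true, if_false, ih']
      have key := realMean_reveal (hG w List.mem_cons_self)
        (fun b g => Φ ((if b then insert w next.toFinset else next.toFinset) ∪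
          ws.toFinset.filter fun x => x ∉ visited ∧ (x, u) ∈ g) g) (by
          intro b g
          have : (ws.toFinset.filter fun x => x ∉ visited ∧ (x, u) ∈ insert (w, u) g) =
              ws.toFinset.filter fun x => x ∉ visited ∧ (x, u) ∈ g := by
            refine Finset.filter_congr fun x hx => ?_
            have : x ≠ w := fun h => hw (by simpa [h] using hx)
            simp [this]
          simp only [this]
          exact hΦ _ w List.mem_cons_self g)
      simp only [if_true, Bool.false_eq_true, if_false] at key
      have hins : (if w ∈ next then next else w :: next).toFinset = insert w next.toFinset := by
        split_ifs with h
        · rw [Finset.insert_eq_of_mem (by simpa using h)]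
        · simp
      rw [hins, ← key]
      refine realMean_congr fun g _ => ?_
      congr 1
      ext x
      by_cases hg : (w, u) ∈ g
      · simp only [hg, decide_true, if_true, Finset.mem_union, Finset.mem_insert,
          List.mem_toFinset, Finset.mem_filter, List.mem_cons]
        by_cases hx : x = w
        · subst hx; simp [hv, hg]
        · simp [hx]
      · simp only [hg, decide_false, Bool.false_eq_true, if_false, Finset.mem_union,
          List.mem_toFinset, Finset.mem_filter, List.mem_cons]
        by_cases hx : x = w
        · subst hx; simp [hg]
        · simp [hx]

variable [Fintype V]

/-- The nodes outside `visited` with a live edge into `us`. -/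
def nextSet (G : Network V) (g : Finset (V × V)) (visited us : Finset V) : Finset V :=
  Finset.univ.filter fun w => w ∉ visited ∧ ∃ u ∈ us, (w, u) ∈ G.edges ∧ (w, u) ∈ g

theorem nextSet_insert (G : Network V) (g : Finset (V × V)) (visited us : Finset V) {w u : V}
    (hu : u ∉ us) : nextSet G (insert (w, u) g) visited us = nextSet G g visited us := by
  refine Finset.filter_congr fun x _ => and_congr_right fun _ => ?_
  refine exists_congr fun y => and_congr_right fun hy => and_congr_right fun _ => ?_
  have : y ≠ u := fun h => hu (h ▸ hy)
  simp [this]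

theorem mem_inNbrs {G : Network V} {v w : V} : w ∈ inNbrs G v ↔ (w, v) ∈ G.edges := by
  simp [inNbrs]

/-- Edges into distinct nodes of the layer are distinct. So while one node is scanned, the remaining
layer and the later search are an admissible continuation for `scanNode_mean`. -/
theorem scanLayer_mean (G : Network V) (visited : List V) (us : List V) (hus : us.Nodup) :
    ∀ (Φ : Finset V → Finset (V × V) → ℝ≥0∞)
      (_ : ∀ X, ∀ u ∈ us, ∀ w g, Φ X (insert (w, u) g) = Φ X g)
      (next : List V) (Et Ef : List (V × V)),
      ((scanLayer G visited us (next, Et, Ef)).mean fun y => realMean G (Φ y.1.1.toFinset)) =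
        realMean G fun g => Φ (next.toFinset ∪ nextSet G g visited.toFinset us.toFinset) g := by
  induction us with
  | nil =>
    intro Φ hΦ next Et Ef
    rw [scanLayer, Prog.mean_pure]
    simp [nextSet]
  | cons u us ih =>
    intro Φ hΦ next Et Ef
    obtain ⟨hu, hnd⟩ := List.nodup_cons.1 hus
    rw [scanLayer, Prog.mean_bind, Prog.mean_tick, Prog.mean_bind]
    simp only [ih hnd Φ fun X x hx => hΦ X x (List.mem_cons_of_mem _ hx)]
    rw [scanNode_mean G visited u (inNbrs G u)
      (fun X g => Φ (X ∪ nextSet G g visited.toFinset us.toFinset) g) (Finset.nodup_toList _)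
      (fun w hw => mem_inNbrs.1 hw)]
    · refine realMean_congr fun g _ => ?_
      congr 1
      rw [Finset.union_assoc]
      congr 1
      ext x
      simp only [nextSet, Finset.mem_union, Finset.mem_filter, List.mem_toFinset, mem_inNbrs,
        Finset.mem_univ, true_and, List.mem_cons, exists_eq_or_imp]
      tauto
    · intro X w _ g
      rw [nextSet_insert _ _ _ _ (by simpa using hu)]
      exact hΦ _ u List.mem_cons_self w g

/-- Reverse breadth-first search in a realization, on the level of node sets. -/
def bfsSet (G : Network V) (Sr : Finset V) (g : Finset (V × V)) :
    ℕ → Finset V → Finset V → Finset V × Bool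
  | 0, _, A => (A, false)
  | fuel + 1, L, A =>
      if L = ∅ then (A, false)
      else if ∃ v ∈ L, v ∈ Sr then (A, true)
      else bfsSet G Sr g fuel (nextSet G g (L ∪ A) L) (L ∪ A)

theorem nextSet_disjoint (G : Network V) (g : Finset (V × V)) (visited us : Finset V) :
    Disjoint (nextSet G g visited us) visited :=
  Finset.disjoint_left.2 fun _ hx => (Finset.mem_filter.1 hx).2.1

/-- The search only inspects edges whose head is in the current layer, and layers stay disjoint from
the visited nodes. Edges into visited nodes are therefore never consulted again, which is what
permits the deferred decisions. -/
theorem bfsSet_insert (G : Network V) (Sr : Finset V) (g : Finset (V × V)) (w u : V) (fuel : ℕ) :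
    ∀ L A : Finset V, Disjoint L A → u ∈ A →
      bfsSet G Sr (insert (w, u) g) fuel L A = bfsSet G Sr g fuel L A := by
  induction fuel with
  | zero => intro L A _ _; rfl
  | succ fuel ih =>
    intro L A hd hu
    rw [bfsSet, bfsSet, nextSet_insert _ _ _ _ (Finset.disjoint_right.1 hd hu),
      ih _ _ (nextSet_disjoint _ _ _ _) (Finset.mem_union_right _ hu)]

theorem bfs_mean (G : Network V) (Sr : Finset V) (H : Finset V × Bool → ℝ≥0∞) (fuel : ℕ) :
    ∀ (layer verts : List V) (Et Ef : List (V × V)), layer.Nodup →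
      ((bfs G Sr fuel layer verts Et Ef).mean fun y => H (y.1.verts.toFinset, y.1.hit)) =
        realMean G fun g => H (bfsSet G Sr g fuel layer.toFinset verts.toFinset) := by
  induction fuel with
  | zero =>
    intro layer verts Et Ef _
    rw [bfs, Prog.mean_pure]
    simp only [bfsSet, realMean_const]
  | succ fuel ih =>
    intro layer verts Et Ef hl
    rw [bfs, Prog.mean_bind, Prog.mean_tick]
    by_cases h0 : layer = []
    · subst h0
      simp only [if_true, Prog.mean_pure, bfsSet, List.toFinset_nil, realMean_const]
    have h0' : layer.toFinset ≠ ∅ := by simpa using h0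
    simp only [if_neg h0, bfsSet, if_neg h0', List.mem_toFinset]
    by_cases h1 : ∃ v ∈ layer, v ∈ Sr
    · simp only [if_pos h1, Prog.mean_pure, realMean_const]
    simp only [if_neg h1, Prog.mean_bind]
    have hA : (layer ++ verts).toFinset = layer.toFinset ∪ verts.toFinset := List.toFinset_append
    -- The continuation must ignore the tested edges for every set X, whereas `bfsSet_insert`
    -- requires disjointness from the visited nodes. Subtracting these nodes from X provides it and
    -- changes nothing for an actual next layer.
    have key := scanLayer_mean G (layer ++ verts) layer hl
      (fun X g => H (bfsSet G Sr g fuel (X \ (layer ++ verts).toFinset) (layer ++ verts).toFinset))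
      (by
        intro X u hu w g
        rw [bfsSet_insert _ _ _ _ _ _ _ _ Finset.sdiff_disjoint (by simp [hu])]) [] Et Ef
    simp only [List.toFinset_nil, Finset.empty_union,
      (nextSet_disjoint G _ (layer ++ verts).toFinset layer.toFinset).sdiff_eq_left] at key
    rw [hA] at key
    rw [← key]
    refine Prog.mean_congr ?_
    refine (scanLayer_always G (layer ++ verts) layer [] Et Ef List.nodup_nil (by simp)).mono ?_
    rintro ⟨⟨next', Et', Ef'⟩, t⟩ ⟨g1, g2, -⟩
    have hd : Disjoint next'.toFinset (layer.toFinset ∪ verts.toFinset) := by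
      rw [← hA, Finset.disjoint_left]
      intro x hx hx'
      exact g2 x (by simpa using hx) (by simpa using hx')
    rw [hd.sdiff_eq_left]
    have := ih next' (layer ++ verts) Et' Ef' g1
    rw [hA] at this
    exact this

end

section

variable {V : Type} [Fintype V] [DecidableEq V]

/-! ### The search and the diffusion in a realization -/

/-- The nodes with a path of fewer than `t` edges to `v`. -/
def backBall (g : Finset (V × V)) (v : V) : ℕ → Finset V
  | 0 => ∅
  | t + 1 => Finset.univ.filter fun w => w = v ∨ ∃ u ∈ backBall g v t, (w, u) ∈ g

theorem mem_backBall_succ {g : Finset (V × V)} {v w : V} {t : ℕ} :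
    w ∈ backBall g v (t + 1) ↔ w = v ∨ ∃ u ∈ backBall g v t, (w, u) ∈ g := by
  simp [backBall]

theorem backBall_subset_succ (g : Finset (V × V)) (v : V) (t : ℕ) :
    backBall g v t ⊆ backBall g v (t + 1) := by
  induction t with
  | zero => simp [backBall]
  | succ t ih =>
    intro w hw
    rw [mem_backBall_succ] at hw ⊢
    exact hw.imp id fun ⟨u, hu, h⟩ => ⟨u, ih hu, h⟩

/-- Invariant: after t rounds the visited set is the ball of index t and the layer is the next
sphere. Each nonempty layer enlarges the ball, so the fuel hypothesis is preserved and excludes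
running out of fuel. -/
theorem bfsSet_spec (G : Network V) (Sr : Finset V) {g : Finset (V × V)} (hg : g ⊆ G.edges) (v : V)
    (fuel : ℕ) :
    ∀ t : ℕ, Fintype.card V + 1 ≤ fuel + (backBall g v t).card →
      Disjoint (backBall g v t) Sr →
      ∃ s, (bfsSet G Sr g fuel (backBall g v (t + 1) \ backBall g v t) (backBall g v t)).1 =
          backBall g v s ∧ Disjoint (backBall g v s) Sr ∧
        ((bfsSet G Sr g fuel (backBall g v (t + 1) \ backBall g v t) (backBall g v t)).2 = true →
          ∃ u ∈ backBall g v (s + 1), u ∈ Sr) := by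
  induction fuel with
  | zero =>
    intro t h _
    have := Finset.card_le_univ (backBall g v t)
    omega
  | succ fuel ih =>
    intro t h hd
    have hu : backBall g v (t + 1) \ backBall g v t ∪ backBall g v t = backBall g v (t + 1) :=
      Finset.sdiff_union_of_subset (backBall_subset_succ g v t)
    have hnext : nextSet G g (backBall g v (t + 1)) (backBall g v (t + 1) \ backBall g v t) =
        backBall g v (t + 2) \ backBall g v (t + 1) := by
      ext w
      simp only [nextSet, Finset.mem_filter, Finset.mem_univ, true_and, Finset.mem_sdiff]
      constructor
      · rintro ⟨h1, u, ⟨h2, -⟩, -, h3⟩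
        exact ⟨mem_backBall_succ.2 (Or.inr ⟨u, h2, h3⟩), h1⟩
      · rintro ⟨h1, h2⟩
        refine ⟨h2, ?_⟩
        rcases mem_backBall_succ.1 h1 with rfl | ⟨u, hu, h3⟩
        · exact absurd (mem_backBall_succ.2 (Or.inl rfl)) h2
        -- A successor in the smaller ball would put w into the ball of index t + 1. Thus the live
        -- edge starts at the next sphere and ends in the current one.
        · exact ⟨u, ⟨hu, fun h4 => h2 (mem_backBall_succ.2 (Or.inr ⟨u, h4, h3⟩))⟩, hg h3, h3⟩
    rw [bfsSet]
    split_ifs with h0 h1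
    · exact ⟨t, rfl, hd, by simp⟩
    · obtain ⟨u, hu1, hu2⟩ := h1
      exact ⟨t, rfl, hd, fun _ => ⟨u, (Finset.mem_sdiff.1 hu1).1, hu2⟩⟩
    · rw [hu, hnext]
      refine ih (t + 1) ?_ ?_
      · have h2 := Finset.card_sdiff_add_card_eq_card (backBall_subset_succ g v t)
        have h3 := Finset.card_pos.2 (Finset.nonempty_iff_ne_empty.2 h0)
        omega
      · rw [← hu, Finset.disjoint_union_left]
        refine ⟨Finset.disjoint_left.2 fun u h3 h4 => h1 ⟨u, h3, h4⟩, hd⟩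

/-! ### The race of the two cascades towards the root -/

/-- The diffusion at time `s`. -/
def diffusion (g : Finset (V × V)) (Sr Sp : Finset V) (s : ℕ) : Cascade V :=
  (Cascade.step g)^[s] (Cascade.init Sr Sp)

theorem diffusion_succ (g : Finset (V × V)) (Sr Sp : Finset V) (s : ℕ) :
    diffusion g Sr Sp (s + 1) = Cascade.step g (diffusion g Sr Sp s) :=
  Function.iterate_succ_apply' _ _ _

theorem mem_rumor_succ {g : Finset (V × V)} {Sr Sp : Finset V} {s : ℕ} {w : V} :
    w ∈ (diffusion g Sr Sp (s + 1)).rumor ↔ w ∈ (diffusion g Sr Sp s).rumor ∨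
      w ∈ (diffusion g Sr Sp (s + 1)).newRumor := by
  simp [diffusion_succ, Cascade.step]

theorem mem_positive_succ {g : Finset (V × V)} {Sr Sp : Finset V} {s : ℕ} {w : V} :
    w ∈ (diffusion g Sr Sp (s + 1)).positive ↔ w ∈ (diffusion g Sr Sp s).positive ∨
      w ∈ (diffusion g Sr Sp (s + 1)).newPositive := by
  simp [diffusion_succ, Cascade.step]

theorem mem_newRumor_succ {g : Finset (V × V)} {Sr Sp : Finset V} {s : ℕ} {w : V} :
    w ∈ (diffusion g Sr Sp (s + 1)).newRumor ↔ (w ∉ (diffusion g Sr Sp s).rumor ∧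
      w ∉ (diffusion g Sr Sp s).positive) ∧ ∃ u ∈ (diffusion g Sr Sp s).newRumor, (u, w) ∈ g := by
  simp [diffusion_succ, Cascade.step]

theorem mem_newPositive_succ {g : Finset (V × V)} {Sr Sp : Finset V} {s : ℕ} {w : V} :
    w ∈ (diffusion g Sr Sp (s + 1)).newPositive ↔ (w ∉ (diffusion g Sr Sp s).rumor ∧
      w ∉ (diffusion g Sr Sp s).positive) ∧ w ∉ (diffusion g Sr Sp (s + 1)).newRumor ∧
      ∃ u ∈ (diffusion g Sr Sp s).newPositive, (u, w) ∈ g := by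
  simp [diffusion_succ, Cascade.step, and_assoc]

/-- The last two clauses carry the later inductions: a node activated before the latest step has
already made its attempts, so all its live out-neighbours are active. -/
theorem diffusion_invariant (g : Finset (V × V)) (Sr Sp : Finset V) (s : ℕ) :
    (∀ w ∈ (diffusion g Sr Sp s).newRumor, w ∈ (diffusion g Sr Sp s).rumor) ∧
    (∀ w ∈ (diffusion g Sr Sp s).newPositive, w ∈ (diffusion g Sr Sp s).positive) ∧
    (∀ w ∈ (diffusion g Sr Sp s).rumor, w ∉ (diffusion g Sr Sp s).positive) ∧
    (∀ u ∈ (diffusion g Sr Sp s).rumor, u ∉ (diffusion g Sr Sp s).newRumor →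
      ∀ w, (u, w) ∈ g → w ∈ (diffusion g Sr Sp s).rumor ∨ w ∈ (diffusion g Sr Sp s).positive) ∧
    (∀ u ∈ (diffusion g Sr Sp s).positive, u ∉ (diffusion g Sr Sp s).newPositive →
      ∀ w, (u, w) ∈ g → w ∈ (diffusion g Sr Sp s).rumor ∨ w ∈ (diffusion g Sr Sp s).positive) := by
  induction s with
  | zero =>
    simp only [diffusion, Cascade.init, Function.iterate_zero, id, Finset.mem_sdiff]
    tauto
  | succ s ih =>
    obtain ⟨h1, h2, h3, h4, h5⟩ := ih
    refine ⟨fun w hw => mem_rumor_succ.2 (Or.inr hw), fun w hw => mem_positive_succ.2 (Or.inr hw),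
      ?_, ?_, ?_⟩
    · intro w hw hw'
      rw [mem_rumor_succ] at hw
      rw [mem_positive_succ, mem_newPositive_succ] at hw'
      have := h3 w
      rcases hw with hw | hw
      · tauto
      · have := mem_newRumor_succ.1 hw
        tauto
    · intro u hu hu' w huw
      have hu1 : u ∈ (diffusion g Sr Sp s).rumor := (mem_rumor_succ.1 hu).resolve_right hu'
      rw [mem_rumor_succ, mem_positive_succ, mem_newRumor_succ]
      by_cases hn : u ∈ (diffusion g Sr Sp s).newRumor
      · have : ∃ u ∈ (diffusion g Sr Sp s).newRumor, (u, w) ∈ g := ⟨u, hn, huw⟩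
        by_cases hwr : w ∈ (diffusion g Sr Sp s).rumor <;>
          by_cases hwp : w ∈ (diffusion g Sr Sp s).positive <;> simp [hwr, hwp, this]
      · have := h4 u hu1 hn w huw
        tauto
    · intro u hu hu' w huw
      have hu1 : u ∈ (diffusion g Sr Sp s).positive := (mem_positive_succ.1 hu).resolve_right hu'
      rw [mem_rumor_succ, mem_positive_succ, mem_newPositive_succ]
      by_cases hn : u ∈ (diffusion g Sr Sp s).newPositive
      · have : ∃ u ∈ (diffusion g Sr Sp s).newPositive, (u, w) ∈ g := ⟨u, hn, huw⟩
        tauto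
      · have := h5 u hu1 hn w huw
        tauto

theorem positive_mono {g : Finset (V × V)} {Sr Sp : Finset V} {s t : ℕ} (h : s ≤ t) :
    (diffusion g Sr Sp s).positive ⊆ (diffusion g Sr Sp t).positive := by
  induction t, h using Nat.le_induction with
  | base => exact subset_rfl
  | succ t _ ih => exact fun w hw => mem_positive_succ.2 (Or.inl (ih hw))

theorem rumor_mono {g : Finset (V × V)} {Sr Sp : Finset V} {s t : ℕ} (h : s ≤ t) :
    (diffusion g Sr Sp s).rumor ⊆ (diffusion g Sr Sp t).rumor := by
  induction t, h using Nat.le_induction with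
  | base => exact subset_rfl
  | succ t _ ih => exact fun w hw => mem_rumor_succ.2 (Or.inl (ih hw))

/-- The rumor advances at most one edge per step, so in s steps it cannot cross a margin of s free
of rumor seeds. -/
theorem rumor_backBall {g : Finset (V × V)} {Sr : Finset V} (Sp : Finset V) {v : V} (s : ℕ) :
    ∀ t, Disjoint (backBall g v (s + t)) Sr →
      ∀ w ∈ backBall g v t, w ∉ (diffusion g Sr Sp s).rumor := by
  induction s with
  | zero =>
    intro t hd w hw hr
    rw [zero_add] at hd
    exact Finset.disjoint_left.1 hd hw (by simpa [diffusion, Cascade.init] using hr)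
  | succ s ih =>
    intro t hd w hw hr
    have ih' := ih (t + 1) (by rwa [show s + (t + 1) = s + 1 + t by omega])
    rcases mem_rumor_succ.1 hr with hr | hr
    · exact ih' w (backBall_subset_succ g v t hw) hr
    · obtain ⟨-, u, hu, huw⟩ := mem_newRumor_succ.1 hr
      exact ih' u (mem_backBall_succ.2 (Or.inr ⟨w, hw, huw⟩))
        ((diffusion_invariant g Sr Sp s).1 u hu)

theorem positive_backBall_disjoint {g : Finset (V × V)} {Sr Sp : Finset V} {v : V} (s : ℕ) :
    ∀ t, Disjoint (backBall g v (s + t)) Sp →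
      ∀ w ∈ backBall g v t, w ∉ (diffusion g Sr Sp s).positive := by
  induction s with
  | zero =>
    intro t hd w hw hr
    rw [zero_add] at hd
    simp only [diffusion, Cascade.init, Function.iterate_zero, id, Finset.mem_sdiff] at hr
    exact Finset.disjoint_left.1 hd hw hr.1
  | succ s ih =>
    intro t hd w hw hr
    have ih' := ih (t + 1) (by rwa [show s + (t + 1) = s + 1 + t by omega])
    rcases mem_positive_succ.1 hr with hr | hr
    · exact ih' w (backBall_subset_succ g v t hw) hr
    · obtain ⟨-, -, u, hu, huw⟩ := mem_newPositive_succ.1 hr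
      exact ih' u (mem_backBall_succ.2 (Or.inr ⟨w, hw, huw⟩))
        ((diffusion_invariant g Sr Sp s).2.1 u hu)

/-- A positive node in the ball has a successor one sphere closer to v. One step later that
successor is active, and `rumor_backBall` forbids the rumor there. So the positive cascade
approaches v by one edge per step or is already closer. -/
theorem positive_backBall {g : Finset (V × V)} {Sr Sp : Finset V} {v u : V} (hu : u ∈ Sp) (s : ℕ) :
    ∀ t, u ∈ backBall g v (s + (t + 1)) → Disjoint (backBall g v (s + (t + 1))) Sr →
      ∃ w ∈ backBall g v (t + 1), w ∈ (diffusion g Sr Sp s).positive := by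
  induction s with
  | zero =>
    intro t hb hd
    rw [zero_add] at hb hd
    refine ⟨u, hb, ?_⟩
    simpa [diffusion, Cascade.init, hu] using Finset.disjoint_left.1 hd hb
  | succ s ih =>
    intro t hb hd
    have e : s + 1 + (t + 1) = s + (t + 1 + 1) := by omega
    obtain ⟨w, hw, hwp⟩ := ih (t + 1) (e ▸ hb) (e ▸ hd)
    by_cases hw' : w ∈ backBall g v (t + 1)
    · exact ⟨w, hw', mem_positive_succ.2 (Or.inl hwp)⟩
    obtain rfl | ⟨x, hx, hwx⟩ := mem_backBall_succ.1 hw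
    · exact absurd (mem_backBall_succ.2 (Or.inl rfl)) hw'
    refine ⟨x, hx, ?_⟩
    have hr := rumor_backBall Sp (s + 1) (t + 1) hd x hx
    have hr0 : x ∉ (diffusion g Sr Sp s).rumor := fun h => hr (mem_rumor_succ.2 (Or.inl h))
    have hr1 : x ∉ (diffusion g Sr Sp (s + 1)).newRumor := fun h => hr (mem_rumor_succ.2 (Or.inr h))
    rw [mem_positive_succ, mem_newPositive_succ]
    by_cases hn : w ∈ (diffusion g Sr Sp s).newPositive
    · have : ∃ u ∈ (diffusion g Sr Sp s).newPositive, (u, x) ∈ g := ⟨w, hn, hwx⟩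
      tauto
    · have := (diffusion_invariant g Sr Sp s).2.2.2.2 w hwp hn x hwx
      tauto

theorem not_rumorActivated {g : Finset (V × V)} {Sr Sp : Finset V} {v u : V} {t : ℕ} (hu : u ∈ Sp)
    (hb : u ∈ backBall g v t) (hd : Disjoint (backBall g v t) Sr) : ¬ RumorActivated g Sr Sp v := by
  rintro ⟨r, hr⟩
  change v ∈ (diffusion g Sr Sp r).rumor at hr
  cases t with
  | zero => simp [backBall] at hb
  | succ t =>
    obtain ⟨w, hw, hwp⟩ := positive_backBall hu t 0 hb hd
    have : w = v := by simpa [backBall] using hw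
    subst this
    exact (diffusion_invariant g Sr Sp (max r t)).2.2.1 w (rumor_mono (le_max_left _ _) hr)
      (positive_mono (le_max_right _ _) hwp)

/-- The mirror image of `positive_backBall`. The positive seeds are excluded only from the smaller
ball, so a positive seed may be as close to v as the rumor seed. Such ties are won by the rumor. -/
theorem rumor_backBall_nonempty {g : Finset (V × V)} {Sr Sp : Finset V} {v : V} (s : ℕ) :
    ∀ t, Disjoint (backBall g v (s + t)) Sr → Disjoint (backBall g v (s + t)) Sp →
      (∃ u ∈ backBall g v (s + t + 1), u ∈ Sr) →
      ∃ w ∈ backBall g v (t + 1), w ∈ (diffusion g Sr Sp s).rumor := by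
  induction s with
  | zero =>
    rintro t - - ⟨u, hu, hur⟩
    rw [zero_add] at hu
    exact ⟨u, hu, by simpa [diffusion, Cascade.init] using hur⟩
  | succ s ih =>
    intro t hd hd' hu
    have e : s + 1 + t = s + (t + 1) := by omega
    rw [e] at hd hd' hu
    obtain ⟨w, hw, hwr⟩ := ih (t + 1) hd hd' hu
    by_cases hw' : w ∈ backBall g v (t + 1)
    · exact ⟨w, hw', mem_rumor_succ.2 (Or.inl hwr)⟩
    obtain rfl | ⟨x, hx, hwx⟩ := mem_backBall_succ.1 hw
    · exact absurd (mem_backBall_succ.2 (Or.inl rfl)) hw'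
    refine ⟨x, hx, ?_⟩
    -- At time s neither cascade has reached x. Hence its rumor predecessor w was activated just
    -- now, and x joins the rumor at time s + 1 by priority.
    have h1 := rumor_backBall Sp s (t + 1) hd x hx
    have h2 := positive_backBall_disjoint (Sr := Sr) s (t + 1) hd' x hx
    rw [mem_rumor_succ, mem_newRumor_succ]
    by_cases hn : w ∈ (diffusion g Sr Sp s).newRumor
    · have : ∃ u ∈ (diffusion g Sr Sp s).newRumor, (u, x) ∈ g := ⟨w, hn, hwx⟩
      tauto
    · have := (diffusion_invariant g Sr Sp s).2.2.2.1 w hwr hn x hwx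
      tauto

theorem rumorActivated_of_backBall {g : Finset (V × V)} {Sr Sp : Finset V} {v : V} {t : ℕ}
    (hd : Disjoint (backBall g v t) Sr) (hd' : Disjoint (backBall g v t) Sp)
    (hu : ∃ u ∈ backBall g v (t + 1), u ∈ Sr) : RumorActivated g Sr Sp v := by
  obtain ⟨w, hw, hwr⟩ := rumor_backBall_nonempty (Sp := Sp) t 0 hd hd' hu
  have : w = v := by simpa [backBall] using hw
  exact ⟨t, this ▸ hwr⟩

theorem bfsSet_root_spec (G : Network V) (Sr : Finset V) {g : Finset (V × V)} (hg : g ⊆ G.edges)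
    (v : V) :
    ∃ s, (bfsSet G Sr g (Fintype.card V + 1) {v} ∅).1 = backBall g v s ∧
      Disjoint (backBall g v s) Sr ∧
      ((bfsSet G Sr g (Fintype.card V + 1) {v} ∅).2 = true →
        ∃ u ∈ backBall g v (s + 1), u ∈ Sr) := by
  have := bfsSet_spec G Sr hg v (Fintype.card V + 1) 0 (by simp) (by simp [backBall])
  have h1 : backBall g v (0 + 1) \ backBall g v 0 = {v} := by ext; simp [backBall]
  have h0 : backBall g v 0 = ∅ := rfl
  rwa [h1, h0] at this

/-! ### Random R-tuples and the objective function -/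

open Classical in
theorem ofReal_f (G : Network V) (Sr Sp : Finset V) :
    ENNReal.ofReal (f G Sr Sp) =
      ∑ v, realMean G fun g => if RumorActivated g Sr Sp v then 0 else 1 := by
  have h : ∀ g (u : V), 0 ≤ prGraph G g * (if RumorActivated g Sr Sp u then (0 : ℝ) else 1) :=
    fun g u => mul_nonneg (prGraph_nonneg G g) (by split_ifs <;> norm_num)
  simp only [f, realMean]
  rw [ENNReal.ofReal_sum_of_nonneg fun g _ => Finset.sum_nonneg fun u _ => h g u,
    Finset.sum_comm]
  refine Finset.sum_congr rfl fun g _ => ?_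
  rw [ENNReal.ofReal_sum_of_nonneg fun u _ => h g u]
  refine Finset.sum_congr rfl fun u _ => ?_
  rw [ENNReal.ofReal_mul (prGraph_nonneg G g)]
  split_ifs <;> simp

theorem randomRTuple_mean [Nonempty V] (G : Network V) (Sr : Finset V)
    (H : Finset V × Bool → ℝ≥0∞) :
    ((randomRTuple G Sr).mean fun y => H (y.1.verts.toFinset, y.1.hit)) =
      (Fintype.card V : ℝ≥0∞)⁻¹ *
        ∑ v, realMean G fun g => H (bfsSet G Sr g (Fintype.card V + 1) {v} ∅) := by
  rw [randomRTuple, Prog.mean_bind, Prog.mean_uniformNode]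
  congr 1
  refine Finset.sum_congr rfl fun v _ => ?_
  rw [rTupleOf]
  exact bfs_mean G Sr H _ [v] [] [] [] (by simp)

/-- For a fixed realization, if the search from v collects u, then the seed set {u} saves v. Summing
over roots v gives f({u}). -/
theorem prob_mem_verts_le [Nonempty V] (G : Network V) (Sr : Finset V) (u : V) :
    ((randomRTuple G Sr).mean fun y => if u ∈ y.1.verts then 1 else 0) ≤
      (Fintype.card V : ℝ≥0∞)⁻¹ * ENNReal.ofReal (f G Sr {u}) := by
  classical
  have := randomRTuple_mean G Sr fun z => if u ∈ z.1 then 1 else 0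
  simp only [List.mem_toFinset] at this
  rw [this, ofReal_f]
  gcongr with v
  refine realMean_mono fun g hg => ?_
  obtain ⟨s, h1, h2, -⟩ := bfsSet_root_spec G Sr hg v
  rw [h1]
  by_cases hu : u ∈ backBall g v s
  · simp [hu, not_rumorActivated (Finset.mem_singleton_self u) hu h2]
  · simp [hu]

/-- The R-tuple is covered by `S`. -/
def RTuple.Covered (S : Finset V) (T : RTuple V) : Prop :=
  T.hit = false ∨ ∃ v ∈ T.verts, v ∈ S

instance (S : Finset V) (T : RTuple V) : Decidable (T.Covered S) :=
  inferInstanceAs (Decidable (T.hit = false ∨ ∃ v ∈ T.verts, v ∈ S))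

/-- If the search from v meets the rumor and V* misses S, then the rumor wins v against S. Only this
direction is needed, as a lower bound on coverage. -/
theorem le_prob_covered [Nonempty V] (G : Network V) (Sr S : Finset V) :
    (Fintype.card V : ℝ≥0∞)⁻¹ * ENNReal.ofReal (f G Sr S) ≤
      (randomRTuple G Sr).mean fun y => if y.1.Covered S then 1 else 0 := by
  have := randomRTuple_mean G Sr fun z => if z.2 = false ∨ ∃ v ∈ z.1, v ∈ S then 1 else 0
  simp only [List.mem_toFinset] at this
  refine le_trans ?_ this.ge
  classical
  rw [ofReal_f]
  gcongr with v
  refine realMean_mono fun g hg => ?_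
  obtain ⟨s, h1, h2, h3⟩ := bfsSet_root_spec G Sr hg v
  rw [h1]
  by_cases hc : (bfsSet G Sr g (Fintype.card V + 1) {v} ∅).2 = false ∨ ∃ x ∈ backBall g v s, x ∈ S
  · simp only [hc, if_true]
    split_ifs <;> simp
  · push Not at hc
    have := rumorActivated_of_backBall (Sp := S) h2 (Finset.disjoint_left.2 fun _ h => hc.2 _ h)
      (h3 (by simpa using hc.1))
    simp [this]

/-! ### Bounds of the objective function and the expected size of an R-tuple -/

theorem f_le_OPT (G : Network V) (Sr S : Finset V) {i : ℕ} (h : S.card ≤ i) :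
    f G Sr S ≤ OPT G Sr i :=
  Finset.le_sup' (f G Sr) (Finset.mem_filter.2 ⟨Finset.mem_univ _, h⟩)

theorem f_nonneg (G : Network V) (Sr S : Finset V) : 0 ≤ f G Sr S :=
  Finset.sum_nonneg fun g _ => Finset.sum_nonneg fun u _ =>
    mul_nonneg (prGraph_nonneg G g) (by split_ifs <;> norm_num)

theorem f_le_card (G : Network V) (Sr S : Finset V) : f G Sr S ≤ Fintype.card V := by
  classical
  have h : ENNReal.ofReal (f G Sr S) ≤ ENNReal.ofReal (Fintype.card V) := by
    rw [ofReal_f]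
    calc _ ≤ ∑ v : V, (1 : ℝ≥0∞) := by
          refine Finset.sum_le_sum fun v _ => ?_
          refine (realMean_mono fun g _ => ?_).trans_eq (realMean_const G 1)
          split_ifs <;> simp
      _ = _ := by simp
  exact (ENNReal.ofReal_le_ofReal_iff (Nat.cast_nonneg _)).1 h

theorem inDegSum_eq (G : Network V) {us : List V} (h : us.Nodup) :
    inDegSum G us = ∑ u, if u ∈ us then (inNbrs G u).length else 0 := by
  rw [inDegSum, ← List.sum_toFinset _ h, ← Finset.sum_filter]
  refine Finset.sum_congr ?_ fun _ _ => rfl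
  ext; simp

theorem length_eq_sum {us : List V} (h : us.Nodup) :
    us.length = ∑ u, if u ∈ us then 1 else 0 := by
  rw [← List.toFinset_card_of_nodup h, Finset.card_eq_sum_ones, ← Finset.sum_filter]
  refine Finset.sum_congr ?_ fun _ _ => rfl
  ext; simp

theorem sum_inNbrs (G : Network V) : ∑ u, (inNbrs G u).length = G.edges.card := by
  rw [Finset.card_eq_sum_card_fiberwise (f := Prod.snd) (t := Finset.univ) (by simp)]
  refine Finset.sum_congr rfl fun u _ => ?_
  rw [inNbrs, Finset.length_toList]
  refine Finset.card_bij (fun w _ => (w, u)) (by simp) (by simp) ?_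
  rintro ⟨w, x⟩ h
  simp only [Finset.mem_filter] at h
  exact ⟨w, by simp [← h.2, h.1], by rw [← h.2]⟩

/-- Linearity of expectation, with each node in V* with probability at most OPT_1/n. In-degrees as
weights count tested edges, and 1 + in-degree gives the size. -/
theorem mean_sum_verts_le [Nonempty V] (G : Network V) (Sr : Finset V) (W : V → ℕ) :
    ((randomRTuple G Sr).mean fun y => ((∑ u, if u ∈ y.1.verts then W u else 0 : ℕ) : ℝ≥0∞)) ≤
      ENNReal.ofReal (((∑ u, W u : ℕ) : ℝ) / Fintype.card V * OPT G Sr 1) := by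
  have h1 : ∀ y : RTuple V × ℕ, ((∑ u, if u ∈ y.1.verts then W u else 0 : ℕ) : ℝ≥0∞) =
      ∑ u, (W u : ℝ≥0∞) * (if u ∈ y.1.verts then 1 else 0) := by
    intro y
    rw [Nat.cast_sum]
    exact Finset.sum_congr rfl fun u _ => by split_ifs <;> simp
  have hn : (0 : ℝ) < Fintype.card V := by exact_mod_cast Fintype.card_pos
  simp only [h1, Prog.mean_sum, Prog.mean_const_mul]
  calc _ ≤ ∑ u, (W u : ℝ≥0∞) * ((Fintype.card V : ℝ≥0∞)⁻¹ * ENNReal.ofReal (OPT G Sr 1)) := by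
        gcongr with u
        refine (prob_mem_verts_le G Sr u).trans ?_
        gcongr
        exact f_le_OPT G Sr _ (by simp)
    _ = _ := by
        rw [← Finset.sum_mul, ENNReal.ofReal_mul (by positivity), ENNReal.ofReal_div_of_pos hn]
        rw [ENNReal.ofReal_natCast, ENNReal.ofReal_natCast, Nat.cast_sum, ENNReal.div_eq_inv_mul]
        ring

theorem expect_numTested_le [Nonempty V] (G : Network V) (Sr : Finset V) :
    (randomRTuple G Sr).expect RTuple.numTested ≤
      ENNReal.ofReal ((G.edges.card : ℝ) / (Fintype.card V : ℝ) * OPT G Sr 1) := by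
  rw [Prog.expect_eq_mean, ← sum_inNbrs]
  refine le_trans (Prog.mean_mono ?_) (mean_sum_verts_le G Sr _)
  refine (randomRTuple_always G Sr).mono ?_
  rintro y ⟨h1, -, h3⟩
  rw [← inDegSum_eq G h1]
  exact_mod_cast h3

theorem mean_size_le [Nonempty V] (G : Network V) (Sr : Finset V) :
    ((randomRTuple G Sr).mean fun y => (y.1.size G : ℝ≥0∞)) ≤
      1 + ENNReal.ofReal (((Fintype.card V + G.edges.card : ℕ) : ℝ) / Fintype.card V *
        OPT G Sr 1) := by
  have h : ∑ u, (1 + (inNbrs G u).length) = Fintype.card V + G.edges.card := by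
    rw [Finset.sum_add_distrib, sum_inNbrs]; simp
  rw [← h, ← Prog.mean_const (randomRTuple G Sr) 1]
  refine le_trans (Prog.mean_mono ?_)
    ((Prog.mean_add _ _ _).le.trans (add_le_add_right (mean_sum_verts_le G Sr _) _))
  refine (randomRTuple_always G Sr).mono ?_
  rintro y ⟨h1, -, -⟩
  have : (∑ u, if u ∈ y.1.verts then 1 + (inNbrs G u).length else 0) =
      y.1.verts.length + inDegSum G y.1.verts := by
    rw [inDegSum_eq G h1, length_eq_sum h1, ← Finset.sum_add_distrib]
    exact Finset.sum_congr rfl fun u _ => by split_ifs <;> simp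
  rw [this, RTuple.size]
  push_cast
  rw [add_assoc]

end

section

variable {V : Type}

/-! ### Node selection -/

/-- Total size of the sets that are not marked as covered. -/
def uncoveredSize (sets : List (List V)) (cov : ℕ → Bool) : ℕ :=
  ∑ i ∈ Finset.range sets.length, if cov i then 0 else (sets.getD i []).length

theorem uncoveredSize_update (sets : List (List V)) (cov : ℕ → Bool) (i : ℕ) (h : cov i = false) :
    uncoveredSize sets (Function.update cov i true) + (sets.getD i []).length =
      uncoveredSize sets cov := by
  by_cases hi : i < sets.length
  · have hi' := Finset.mem_range.2 hi
    rw [uncoveredSize, uncoveredSize, ← Finset.add_sum_erase _ _ hi',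
      ← Finset.add_sum_erase (Finset.range sets.length) (fun i => if cov i then 0 else _) hi']
    have : ∀ j ∈ (Finset.range sets.length).erase i,
        (if Function.update cov i true j then 0 else (sets.getD j []).length) =
          if cov j then 0 else (sets.getD j []).length := by
      intro j hj
      rw [Function.update_of_ne (Finset.ne_of_mem_erase hj)]
    rw [Finset.sum_congr rfl this]
    simp [h]
    omega
  · have : sets.getD i [] = [] := by
      rw [List.getD_eq_getElem?_getD, List.getElem?_eq_none (by omega)]; rfl
    rw [this, List.length_nil, add_zero]
    refine Finset.sum_congr rfl fun j hj => ?_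
    have : j ≠ i := by rintro rfl; exact hi (Finset.mem_range.1 hj)
    rw [Function.update_of_ne this]

theorem uncoveredSize_none (sets : List (List V)) :
    uncoveredSize sets (fun _ => false) = (sets.map List.length).sum := by
  simp only [uncoveredSize, Bool.false_eq_true, if_false]
  rw [Finset.sum_range, ← List.sum_ofFn]
  congr 1
  refine List.ext_getElem (by simp) fun i h1 h2 => ?_
  simp

/-- Work that is left for the nodes in the buckets `0, …, c`. -/
def bucketWork (occ : V → List ℕ) (c : ℕ) (bucket : ℕ → List V) : ℕ :=
  ∑ j ∈ Finset.range (c + 1), ((bucket j).map fun v => j + (occ v).length + 1).sum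

theorem bucketWork_update (occ : V → List ℕ) {c j : ℕ} (hj : j ≤ c) (bucket : ℕ → List V)
    (l : List V) :
    bucketWork occ c (Function.update bucket j l) +
        ((bucket j).map fun v => j + (occ v).length + 1).sum =
      bucketWork occ c bucket + (l.map fun v => j + (occ v).length + 1).sum := by
  have hj' : j ∈ Finset.range (c + 1) := Finset.mem_range.2 (by omega)
  rw [bucketWork, bucketWork, ← Finset.add_sum_erase _ _ hj',
    ← Finset.add_sum_erase (Finset.range (c + 1)) (fun j => ((bucket j).map _).sum) hj']
  have : ∀ i ∈ (Finset.range (c + 1)).erase j,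
      ((Function.update bucket j l i).map fun v => i + (occ v).length + 1).sum =
        ((bucket i).map fun v => i + (occ v).length + 1).sum := by
    intro i hi
    rw [Function.update_of_ne (Finset.ne_of_mem_erase hi)]
  rw [Finset.sum_congr rfl this, Function.update_self]
  omega

theorem bucketWork_update_cons_le (occ : V → List ℕ) (c j : ℕ) (bucket : ℕ → List V) (v : V) :
    bucketWork occ c (Function.update bucket j (v :: bucket j)) ≤
      bucketWork occ c bucket + (j + (occ v).length + 1) := by
  by_cases hj : j ≤ c
  · have := bucketWork_update occ hj bucket (v :: bucket j)
    simp only [List.map_cons, List.sum_cons] at this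
    omega
  · refine le_add_right (Finset.sum_le_sum fun i hi => ?_)
    have : i ≠ j := by rintro rfl; exact hj (by simpa [Nat.lt_succ_iff] using hi)
    rw [Function.update_of_ne this]

theorem mem_foldl_bucket (cnt : V → ℕ) (nodes : List V) :
    ∀ (bucket : ℕ → List V) (j : ℕ) (v : V),
      v ∈ nodes.foldl (fun b v => Function.update b (cnt v) (v :: b (cnt v))) bucket j ↔
        v ∈ bucket j ∨ v ∈ nodes ∧ cnt v = j := by
  induction nodes with
  | nil => intro bucket j v; simp
  | cons w nodes ih =>
    intro bucket j v
    rw [List.foldl_cons, ih]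
    by_cases h : j = cnt w
    · subst h
      rw [Function.update_self, List.mem_cons, List.mem_cons]
      constructor
      · rintro ((rfl | h) | h)
        · exact Or.inr ⟨Or.inl rfl, rfl⟩
        · exact Or.inl h
        · exact Or.inr ⟨Or.inr h.1, h.2⟩
      · rintro (h | ⟨rfl | h, h'⟩)
        · exact Or.inl (Or.inr h)
        · exact Or.inl (Or.inl rfl)
        · exact Or.inr ⟨h, h'⟩
    · rw [Function.update_of_ne h, List.mem_cons]
      constructor
      · rintro (h | h)
        · exact Or.inl h
        · exact Or.inr ⟨Or.inr h.1, h.2⟩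
      · rintro (h' | ⟨rfl | h', h''⟩)
        · exact Or.inl h'
        · exact absurd h''.symm h
        · exact Or.inr ⟨h', h''⟩

theorem bucketWork_foldl_le (occ : V → List ℕ) (c : ℕ) (cnt : V → ℕ) (nodes : List V) :
    ∀ bucket : ℕ → List V,
      bucketWork occ c (nodes.foldl (fun b v => Function.update b (cnt v) (v :: b (cnt v))) bucket) ≤
        bucketWork occ c bucket + (nodes.map fun v => cnt v + (occ v).length + 1).sum := by
  induction nodes with
  | nil => intro bucket; simp
  | cons w nodes ih =>
    intro bucket
    rw [List.foldl_cons, List.map_cons, List.sum_cons]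
    have h1 := ih (Function.update bucket (cnt w) (w :: bucket (cnt w)))
    have h2 := bucketWork_update_cons_le occ c (cnt w) bucket w
    omega

/-- The sets that matter for node selection. -/
def hitSets (R : List (RTuple V)) : List (List V) :=
  (R.filter fun T => T.hit).map fun T => T.verts

theorem hitSets_length_le (R : List (RTuple V)) : (hitSets R).length ≤ R.length := by
  rw [hitSets, List.length_map]
  exact List.length_filter_le _ _

variable [DecidableEq V]

theorem foldl_cons_occ_length (i : ℕ) (s : List V) (v : V) :
    ∀ occ : V → List ℕ,
      (s.foldl (fun o v => Function.update o v (i :: o v)) occ v).length =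
        (occ v).length + s.count v := by
  induction s with
  | nil => intro occ; simp
  | cons w s ih =>
    intro occ
    rw [List.foldl_cons, ih, List.count_cons]
    by_cases h : w = v
    · subst h; simp; omega
    · rw [Function.update_of_ne (Ne.symm h)]; simp [h]

theorem buildOcc_spec (sets : List (List V)) :
    ∀ (i : ℕ) (occ : V → List ℕ),
      (∀ v, ((buildOcc i sets occ).1 v).length =
        (occ v).length + (sets.map fun s => s.count v).sum) ∧
      (buildOcc i sets occ).2 = 2 * (sets.map List.length).sum + sets.length := by
  induction sets with
  | nil => intro i occ; simp [buildOcc]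
  | cons s ss ih =>
    intro i occ
    obtain ⟨h1, h2⟩ := ih (i + 1) (s.foldl (fun o v => Function.update o v (i :: o v)) occ)
    simp only [buildOcc, h1, h2, foldl_cons_occ_length, List.map_cons, List.sum_cons,
      List.length_cons]
    exact ⟨fun v => by omega, by omega⟩

theorem foldl_decrease_le (s : List V) :
    ∀ (cnt : V → ℕ) (v : V),
      s.foldl (fun c w => Function.update c w (c w - 1)) cnt v ≤ cnt v := by
  induction s with
  | nil => intro cnt v; simp
  | cons w s ih =>
    intro cnt v
    rw [List.foldl_cons]
    refine (ih _ v).trans ?_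
    by_cases h : v = w
    · subst h; simp
    · rw [Function.update_of_ne h]

/-- A set pays for its members only once, when it leaves the uncovered ones. Counts only decrease,
which makes lazy bucket updates legitimate. -/
theorem coverSets_spec (sets : List (List V)) (is : List ℕ) :
    ∀ (cnt : V → ℕ) (cov : ℕ → Bool),
      (∀ v, (coverSets sets is cnt cov).1.1 v ≤ cnt v) ∧
      (coverSets sets is cnt cov).2 + uncoveredSize sets (coverSets sets is cnt cov).1.2 ≤
        is.length + uncoveredSize sets cov := by
  induction is with
  | nil => intro cnt cov; simp [coverSets]
  | cons i is ih =>
    intro cnt cov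
    by_cases h : cov i = true
    · obtain ⟨h1, h2⟩ := ih cnt cov
      simp only [coverSets, h, if_true, List.length_cons]
      exact ⟨h1, by omega⟩
    · have h' : cov i = false := by simpa using h
      obtain ⟨h1, h2⟩ := ih ((sets.getD i []).foldl (fun c w => Function.update c w (c w - 1)) cnt)
        (Function.update cov i true)
      have h3 := uncoveredSize_update sets cov i h'
      simp only [coverSets, h', Bool.false_eq_true, if_false, List.length_cons]
      exact ⟨fun v => (h1 v).trans (foldl_decrease_le _ _ _), by omega⟩

/-- A potential argument. A node in bucket j carries j + |occ v| + 1: at most j moves to lower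
buckets, the inspection of its sets when chosen, and the round in which it is chosen. Descending
through empty buckets is paid by c, and newly covered sets by `uncoveredSize`. -/
theorem selectLoop_cost (sets : List (List V)) (occ : V → List ℕ) (fuel : ℕ) :
    ∀ (k c : ℕ) (cnt : V → ℕ) (cov : ℕ → Bool) (bucket : ℕ → List V) (sel : List V),
      (∀ j, ∀ v ∈ bucket j, cnt v ≤ j) →
      (selectLoop sets occ fuel k c cnt cov bucket sel).2 ≤
        bucketWork occ c bucket + c + 1 + uncoveredSize sets cov := by
  induction fuel with
  | zero => intro k c cnt cov bucket sel _; simp [selectLoop]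
  | succ fuel ih =>
    intro k c cnt cov bucket sel hb
    cases k with
    | zero => simp [selectLoop]; omega
    | succ k =>
      rw [selectLoop]
      split
      · rename_i h0
        split_ifs with hc
        · simp; omega
        · have h1 := ih (k + 1) (c - 1) cnt cov bucket sel hb
          -- The bucket left behind is empty and contributes nothing.
          have h2 : bucketWork occ c bucket = bucketWork occ (c - 1) bucket := by
            obtain ⟨d, rfl⟩ := Nat.exists_eq_succ_of_ne_zero hc
            simp only [bucketWork, Nat.succ_eq_add_one, Nat.add_sub_cancel]
            rw [Finset.sum_range_succ _ (d + 1), h0]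
            simp
          simp only
          omega
      · rename_i v vs hv
        have hvs : ∀ w ∈ vs, w ∈ bucket c := fun w hw => hv ▸ List.mem_cons_of_mem _ hw
        have hb' : ∀ j, ∀ w ∈ Function.update bucket c vs j, cnt w ≤ j := by
          intro j w hw
          by_cases hj : j = c
          · subst hj; rw [Function.update_self] at hw; exact hb j w (hvs w hw)
          · rw [Function.update_of_ne hj] at hw; exact hb j w hw
        have hw := bucketWork_update occ le_rfl bucket vs (c := c)
        rw [hv, List.map_cons, List.sum_cons] at hw
        split_ifs with hc
        · obtain ⟨h1, h2⟩ := coverSets_spec sets (occ v) cnt cov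
          have h3 := ih k c (coverSets sets (occ v) cnt cov).1.1
            (coverSets sets (occ v) cnt cov).1.2 (Function.update bucket c vs) (v :: sel)
            fun j w hw => (h1 w).trans (hb' j w hw)
          simp only
          omega
        -- An outdated node only moves down, so its potential drops by at least the one step spent.
        · have hlt : cnt v < c :=
            lt_of_le_of_ne (hb c v (hv ▸ List.mem_cons_self)) hc
          have e : bucket (cnt v) = Function.update bucket c vs (cnt v) := by
            rw [Function.update_of_ne hlt.ne]
          rw [e]
          have h3 := ih (k + 1) c cnt cov (Function.update (Function.update bucket c vs) (cnt v)
            (v :: Function.update bucket c vs (cnt v))) sel (by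
              intro j w hw
              by_cases hj : j = cnt v
              · subst hj
                rw [Function.update_self] at hw
                rcases List.mem_cons.1 hw with rfl | hw
                · exact le_rfl
                · exact hb' _ w hw
              · rw [Function.update_of_ne hj] at hw; exact hb' j w hw)
          have h4 := bucketWork_update occ hlt.le (Function.update bucket c vs)
            (v :: Function.update bucket c vs (cnt v))
          rw [List.map_cons, List.sum_cons] at h4
          simp only
          omega

theorem selectLoop_length (sets : List (List V)) (occ : V → List ℕ) (fuel : ℕ) :
    ∀ (k c : ℕ) (cnt : V → ℕ) (cov : ℕ → Bool) (bucket : ℕ → List V) (sel : List V),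
      (selectLoop sets occ fuel k c cnt cov bucket sel).1.length ≤ sel.length + k ∧
      ∀ v ∈ sel, v ∈ (selectLoop sets occ fuel k c cnt cov bucket sel).1 := by
  induction fuel with
  | zero => intro k c cnt cov bucket sel; simp [selectLoop]
  | succ fuel ih =>
    intro k c cnt cov bucket sel
    cases k with
    | zero => simp [selectLoop]
    | succ k =>
      rw [selectLoop]
      split
      · split_ifs with hc
        · simp
        · exact ih _ _ _ _ _ _
      · rename_i v vs hv
        split_ifs with hc
        · obtain ⟨h1, h2⟩ := ih k c (coverSets sets (occ v) cnt cov).1.1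
            (coverSets sets (occ v) cnt cov).1.2 (Function.update bucket c vs) (v :: sel)
          rw [List.length_cons] at h1
          exact ⟨by simp only; omega, fun w hw => h2 w (List.mem_cons_of_mem _ hw)⟩
        · exact ih _ _ _ _ _ _

/-- Before the first choice every node sits in the bucket of its exact count. The loop descends to
the highest nonempty bucket and takes a node of maximum count. No further property of greedy is
needed for the running time. -/
theorem selectLoop_first (sets : List (List V)) (occ : V → List ℕ) (nodes : List V)
    (hn : nodes ≠ []) (cnt : V → ℕ) (cov : ℕ → Bool) (bucket : ℕ → List V)
    (hb : ∀ j v, v ∈ bucket j ↔ v ∈ nodes ∧ cnt v = j) (k : ℕ) (sel : List V) (fuel : ℕ) :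
    ∀ c : ℕ, c + 1 ≤ fuel → (∀ v ∈ nodes, cnt v ≤ c) →
      ∃ u ∈ (selectLoop sets occ fuel (k + 1) c cnt cov bucket sel).1,
        ∀ v ∈ nodes, cnt v ≤ cnt u := by
  induction fuel with
  | zero => intro c hc; omega
  | succ fuel ih =>
    intro c hc hle
    rw [selectLoop]
    split
    · rename_i h0
      have hlt : ∀ v ∈ nodes, cnt v < c := fun v hv =>
        lt_of_le_of_ne (hle v hv) fun h => by
          have := (hb c v).2 ⟨hv, h⟩
          rw [h0] at this
          simp at this
      obtain ⟨w, hw⟩ := List.exists_mem_of_ne_nil nodes hn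
      have := hlt w hw
      rw [if_neg (by omega)]
      exact ih (c - 1) (by omega) fun v hv => by have := hlt v hv; omega
    · rename_i v vs hv
      have hvc := ((hb c v).1 (hv ▸ List.mem_cons_self)).2
      rw [if_pos hvc]
      exact ⟨v, (selectLoop_length _ _ _ _ _ _ _ _ _).2 v List.mem_cons_self,
        fun w hw => (hle w hw).trans hvc.ge⟩

theorem nodeSelection_length (nodes : List V) (R : List (RTuple V)) (k : ℕ) :
    (nodeSelection nodes R k).1.length ≤ k := by
  refine le_trans (selectLoop_length _ _ _ _ _ _ _ _ []).1 (by simp)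

theorem countP_covered_eq (R : List (RTuple V)) (hR : ∀ T ∈ R, T.verts.Nodup) (v : V) :
    R.countP (fun T => !T.hit || decide (v ∈ T.verts)) =
      R.countP (fun T => !T.hit) + ((hitSets R).map fun s => s.count v).sum := by
  induction R with
  | nil => simp [hitSets]
  | cons T R ih =>
    have ih' := ih fun T hT => hR T (List.mem_cons_of_mem _ hT)
    have hT := hR T List.mem_cons_self
    rw [List.countP_cons, List.countP_cons, ih']
    cases h : T.hit
    · simp [hitSets, h]; omega
    · have := hT.count (a := v)
      simp [hitSets, h, this]
      omega

/-- The first chosen node u maximizes the number of occurrences in the sets with B = 1, and R-tuples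
with B = 0 count equally for all nodes. Later choices cannot reduce the coverage. -/
theorem nodeSelection_coverage (nodes : List V) (R : List (RTuple V)) (k : ℕ) (hk : 1 ≤ k)
    (hR : ∀ T ∈ R, T.verts.Nodup) {v : V} (hv : v ∈ nodes) :
    R.countP (fun T => decide (T.Covered {v})) ≤
      (coverage (nodeSelection nodes R k).1 R).1 := by
  obtain ⟨k, rfl⟩ := Nat.exists_eq_add_of_le' hk
  have hcnt : ∀ w, ((buildOcc 0 (hitSets R) fun _ => []).1 w).length =
      ((hitSets R).map fun s => s.count w).sum := by
    intro w
    simpa using (buildOcc_spec (hitSets R) 0 fun _ => []).1 w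
  have hle : ∀ w, ((hitSets R).map fun s => s.count w).sum ≤ (hitSets R).length := by
    intro w
    have := List.sum_le_card_nsmul ((hitSets R).map fun s => s.count w) 1 (by
      simp only [List.mem_map, hitSets, List.mem_filter]
      rintro _ ⟨_, ⟨T, ⟨hT, -⟩, rfl⟩, rfl⟩
      exact List.nodup_iff_count_le_one.1 (hR T hT) w)
    simpa using this
  have hfuel : (hitSets R).length + 1 ≤ ((hitSets R).length + 1) * (nodes.length + 1) :=
    Nat.le_mul_of_pos_right _ (by omega)
  obtain ⟨u, hu, hmax⟩ := selectLoop_first (hitSets R) (buildOcc 0 (hitSets R) fun _ => []).1 nodes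
    (List.ne_nil_of_mem hv) (fun w => ((buildOcc 0 (hitSets R) fun _ => []).1 w).length)
    (fun _ => false) _ (fun j w => (mem_foldl_bucket
      (fun w => ((buildOcc 0 (hitSets R) fun _ => []).1 w).length) nodes (fun _ => []) j w).trans (by simp))
    k [] _ _ hfuel
    (fun w _ => (hcnt w).le.trans (hle w))
  have hmax' := hmax v hv
  simp only [hcnt] at hmax'
  calc R.countP (fun T => decide (T.Covered {v}))
      = R.countP (fun T => !T.hit || decide (v ∈ T.verts)) := by
        congr 1
        funext T
        cases h : T.hit <;> simp [RTuple.Covered, h]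
    _ ≤ R.countP (fun T => !T.hit || decide (u ∈ T.verts)) := by
        rw [countP_covered_eq R hR, countP_covered_eq R hR]
        omega
    _ ≤ _ := by
        refine List.countP_mono_left fun T _ hT => ?_
        rw [Bool.or_eq_true] at hT ⊢
        refine hT.imp id fun h => List.any_eq_true.2 ⟨u, by simpa using h, ?_⟩
        exact decide_eq_true hu

/-- Every R-tuple covered by `v` halves the weight of a collection. -/
noncomputable def weight (v : V) (R : List (RTuple V)) : ℝ≥0∞ :=
  2⁻¹ ^ R.countP fun T => decide (T.Covered {v})

theorem weight_cons (v : V) (T : RTuple V) (R : List (RTuple V)) :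
    weight v (T :: R) = weight v R * if T.Covered {v} then 2⁻¹ else 1 := by
  rw [weight, weight, List.countP_cons]
  by_cases h : T.Covered {v} <;> simp [h, pow_succ]

variable [Fintype V]

/-- Total size of the R-tuples in a collection. -/
noncomputable def totalSize (G : Network V) (R : List (RTuple V)) : ℕ :=
  (R.map fun T => T.size G).sum

@[simp] theorem totalSize_nil (G : Network V) : totalSize G [] = 0 := rfl

@[simp] theorem totalSize_cons (G : Network V) (T : RTuple V) (R : List (RTuple V)) :
    totalSize G (T :: R) = T.size G + totalSize G R := rfl

theorem length_add_sum_verts_le (G : Network V) (R : List (RTuple V)) :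
    (R.map fun T => T.verts.length + 1).sum ≤ totalSize G R := by
  induction R with
  | nil => simp
  | cons T R ih =>
    rw [List.map_cons, List.sum_cons, totalSize_cons, RTuple.size]
    omega

theorem length_add_hitSets_le (G : Network V) (R : List (RTuple V)) :
    R.length + ((hitSets R).map List.length).sum ≤ totalSize G R := by
  refine le_trans ?_ (length_add_sum_verts_le G R)
  induction R with
  | nil => simp [hitSets]
  | cons T R ih =>
    cases h : T.hit
    all_goals
      simp only [hitSets, List.filter_cons, h, List.length_cons, List.map_cons, List.sum_cons,
        if_true, Bool.false_eq_true, if_false] at ih ⊢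
      omega

theorem sum_count_univ (sets : List (List V)) :
    ∑ v, (sets.map fun s => s.count v).sum = (sets.map List.length).sum := by
  induction sets with
  | nil => simp
  | cons s ss ih =>
    simp only [List.map_cons, List.sum_cons, Finset.sum_add_distrib, ih]
    congr 1
    rw [← Multiset.coe_card, ← Multiset.sum_count_eq_card (s := Finset.univ) (by simp)]
    simp

/-- With S the total size of the sets with B = 1, building the lists costs 2S, the potential of the
buckets 2S and covering S. The remaining terms are multiples of n, of |R| and constants. -/
theorem nodeSelection_cost (G : Network V) (R : List (RTuple V)) (k : ℕ) :
    (nodeSelection Finset.univ.toList R k).2 ≤ 3 * Fintype.card V + 5 * totalSize G R + 2 := by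
  have hS := length_add_hitSets_le G R
  have hl := hitSets_length_le R
  obtain ⟨h1, h2⟩ := buildOcc_spec (hitSets R) 0 fun _ => []
  have hsum : ∑ v, (((buildOcc 0 (hitSets R) fun _ => []).1 v).length +
      ((buildOcc 0 (hitSets R) fun _ => []).1 v).length + 1) =
        2 * ((hitSets R).map List.length).sum + Fintype.card V := by
    simp only [h1, List.length_nil, zero_add, Finset.sum_add_distrib, sum_count_univ,
      Finset.sum_const, Finset.card_univ, smul_eq_mul, mul_one]
    omega
  have h3 := selectLoop_cost (hitSets R) (buildOcc 0 (hitSets R) fun _ => []).1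
    (((hitSets R).length + 1) * ((Finset.univ : Finset V).toList.length + 1)) k (hitSets R).length
    (fun w => ((buildOcc 0 (hitSets R) fun _ => []).1 w).length) (fun _ => false) _ []
    (fun j v hv => ((mem_foldl_bucket (fun w => ((buildOcc 0 (hitSets R) fun _ => []).1 w).length)
      (Finset.univ : Finset V).toList (fun _ => []) j v).1 hv).elim (fun h => by simp at h)
      fun h => h.2.le)
  have h4 := bucketWork_foldl_le (buildOcc 0 (hitSets R) fun _ => []).1 (hitSets R).length
    (fun w => ((buildOcc 0 (hitSets R) fun _ => []).1 w).length) (Finset.univ : Finset V).toList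
    fun _ => []
  have h5 : bucketWork (buildOcc 0 (hitSets R) fun _ => []).1 (hitSets R).length
      (fun _ => ([] : List V)) = 0 := by simp [bucketWork]
  rw [h5, zero_add, Finset.sum_map_toList, hsum] at h4
  rw [uncoveredSize_none] at h3
  calc (nodeSelection Finset.univ.toList R k).2
      = _ + (buildOcc 0 (hitSets R) fun _ => ([] : List ℕ)).2 +
        (2 * (Finset.univ : Finset V).toList.length + 2 * R.length + 1) := rfl
    _ ≤ _ := Nat.add_le_add_right (Nat.add_le_add_right (h3.trans (Nat.add_le_add_right
        (Nat.add_le_add_right (Nat.add_le_add_right h4 _) _) _)) _) _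
    _ ≤ _ := by
        rw [h2, Finset.length_toList, Finset.card_univ]
        omega

end

section

variable {V : Type} [Fintype V] [DecidableEq V]

/-! ### Failure of a round of the estimation phase -/

/-- The number of R-tuples in the collection after round `i`. -/
noncomputable def roundSize (n k : ℕ) (N δ : ℝ) (i : ℕ) : ℕ :=
  if i = 0 then 0 else ⌊lam n k N δ / (n / 2 ^ i) + 1⌋₊

/-- Round `i` does not return an estimate on the collection `R`. -/
def RoundFails (V : Type) [Fintype V] [DecidableEq V] (k : ℕ) (N δ : ℝ) (i : ℕ)
    (R : List (RTuple V)) : Prop :=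
  i = 0 ∨ ¬ (1 + δ) * (Fintype.card V / 2 ^ i : ℝ) ≤
    Fintype.card V * (coverage (nodeSelection (Finset.univ : Finset V).toList R k).1 R).1 /
      (lam (Fintype.card V) k N δ / (Fintype.card V / 2 ^ i))

theorem roundSize_mono (n k : ℕ) (N δ : ℝ) (i : ℕ) :
    roundSize n k N δ i ≤ roundSize n k N δ (i + 1) := by
  rw [roundSize, roundSize, if_neg (Nat.succ_ne_zero i)]
  split_ifs with h
  · exact Nat.zero_le _
  · have e : lam n k N δ / (n / 2 ^ (i + 1)) = 2 * (lam n k N δ / (n / 2 ^ i)) := by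
      rw [div_div_eq_mul_div, div_div_eq_mul_div, pow_succ]; ring
    rw [e]
    rcases le_or_gt 0 (lam n k N δ / (n / 2 ^ i)) with h0 | h0
    · exact Nat.floor_le_floor (by linarith)
    -- For small N the quantity λ can be negative. Then the round has size 0.
    · rw [Nat.floor_eq_zero.2 (by linarith)]
      exact Nat.zero_le _

open Classical in
/-- Indicator function of the failure of a round. -/
noncomputable def failInd (k : ℕ) (N δ : ℝ) (i : ℕ) (R : List (RTuple V)) : ℝ≥0∞ :=
  if RoundFails V k N δ i R then 1 else 0

theorem failInd_le_one (k : ℕ) (N δ : ℝ) (i : ℕ) (R : List (RTuple V)) :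
    failInd k N δ i R ≤ 1 := by
  rw [failInd]; split_ifs <;> simp

variable [Nonempty V]

/-! ### Collections of random R-tuples -/

theorem generate_always (G : Network V) (Sr : Finset V) (j : ℕ) :
    ∀ R : List (RTuple V), (∀ T ∈ R, T.verts.Nodup) →
      (generate G Sr j R).Always fun y =>
        y.1.length = R.length + j ∧ (∀ T ∈ y.1, T.verts.Nodup) ∧
        y.2 + 8 * totalSize G R ≤ 8 * totalSize G y.1 := by
  induction j with
  | zero =>
    intro R hR
    rw [generate]
    exact Prog.always_pure ⟨rfl, hR, by simp⟩
  | succ j ih =>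
    intro R hR
    rw [generate]
    refine Prog.always_tick_bind (Prog.always_bind ?_)
    refine (randomRTuple_always G Sr).mono ?_
    rintro ⟨T, t⟩ ⟨h1, h2, -⟩
    refine (ih (T :: R) (by simpa [h1] using hR)).mono ?_
    rintro y ⟨g1, g2, g3⟩
    have : 1 ≤ T.size G := by rw [RTuple.size]; omega
    simp only [List.length_cons, totalSize_cons] at *
    exact ⟨by omega, g2, by omega⟩

theorem generate_succ_mean (G : Network V) (Sr : Finset V) (j : ℕ) (R : List (RTuple V))
    (h : List (RTuple V) → ℝ≥0∞) :
    ((generate G Sr (j + 1) R).mean fun y => h y.1) =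
      (randomRTuple G Sr).mean fun x => (generate G Sr j (x.1 :: R)).mean fun y => h y.1 := by
  rw [generate, Prog.mean_bind, Prog.mean_tick, Prog.mean_bind]

theorem generate_add_mean (G : Network V) (Sr : Finset V) (i j : ℕ) (h : List (RTuple V) → ℝ≥0∞) :
    ∀ R : List (RTuple V), ((generate G Sr (i + j) R).mean fun y => h y.1) =
      (generate G Sr i R).mean fun x => (generate G Sr j x.1).mean fun y => h y.1 := by
  induction i with
  | zero => intro R; rw [zero_add, generate, Prog.mean_pure]
  | succ i ih =>
    intro R
    rw [show i + 1 + j = i + j + 1 by omega, generate_succ_mean,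
      generate_succ_mean G Sr i R fun R' => (generate G Sr j R').mean fun y => h y.1]
    simp only [ih]

/-- Expected size of a random R-tuple. -/
noncomputable def meanSize (G : Network V) (Sr : Finset V) : ℝ≥0∞ :=
  (randomRTuple G Sr).mean fun y => (y.1.size G : ℝ≥0∞)

theorem generate_mean_totalSize (G : Network V) (Sr : Finset V) (j : ℕ) :
    ∀ R : List (RTuple V), ((generate G Sr j R).mean fun y => (totalSize G y.1 : ℝ≥0∞)) =
      totalSize G R + j * meanSize G Sr := by
  induction j with
  | zero => intro R; rw [generate, Prog.mean_pure]; simp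
  | succ j ih =>
    intro R
    rw [generate_succ_mean G Sr j R fun R => (totalSize G R : ℝ≥0∞)]
    simp only [ih, totalSize_cons, Nat.cast_add, Prog.mean_add, Prog.mean_const]
    rw [← meanSize]
    push_cast
    ring

/-- Expected factor that a random R-tuple contributes to the weight. -/
noncomputable def meanWeight (G : Network V) (Sr : Finset V) (v : V) : ℝ≥0∞ :=
  (randomRTuple G Sr).mean fun y => if y.1.Covered {v} then 2⁻¹ else 1

theorem meanWeight_add (G : Network V) (Sr : Finset V) (v : V) :
    meanWeight G Sr v +
      2⁻¹ * ((randomRTuple G Sr).mean fun y => if y.1.Covered {v} then 1 else 0) = 1 := by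
  rw [meanWeight, ← Prog.mean_const_mul, ← Prog.mean_add]
  refine Eq.trans ?_ (Prog.mean_const (randomRTuple G Sr) 1)
  congr 1
  funext y
  split_ifs
  · rw [mul_one, ENNReal.inv_two_add_inv_two]
  · simp

theorem half_le_meanWeight (G : Network V) (Sr : Finset V) (v : V) :
    2⁻¹ ≤ meanWeight G Sr v := by
  rw [← Prog.mean_const (randomRTuple G Sr) 2⁻¹]
  refine Prog.mean_mono (Prog.always_of_forall fun y => ?_)
  split_ifs
  · exact le_rfl
  · exact ENNReal.inv_le_one.2 (by norm_num)

/-- The factor is at most 1 and its mean is at least 1/2, so the size under the tilted law has at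
most twice its original mean. -/
theorem mean_weight_mul_size_le (G : Network V) (Sr : Finset V) (v : V) :
    ((randomRTuple G Sr).mean fun y => (if y.1.Covered {v} then 2⁻¹ else 1) * (y.1.size G : ℝ≥0∞)) ≤
      meanWeight G Sr v * (2 * meanSize G Sr) := by
  calc _ ≤ meanSize G Sr := by
        refine Prog.mean_mono (Prog.always_of_forall fun y => ?_)
        refine mul_le_of_le_one_left zero_le ?_
        split_ifs
        · exact ENNReal.inv_le_one.2 (by norm_num)
        · exact le_rfl
    _ = 2⁻¹ * (2 * meanSize G Sr) := by
        rw [← mul_assoc, ENNReal.inv_mul_cancel (by norm_num) (by norm_num), one_mul]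
    _ ≤ _ := by gcongr; exact half_le_meanWeight G Sr v

/-- The R-tuples are independent, so the weights multiply. The affine factor in the total size is
carried through the induction because a failed round hands its whole collection to the next one. -/
theorem generate_mean_weight_le (G : Network V) (Sr : Finset V) (v : V) (X Y : ℝ≥0∞) (j : ℕ) :
    ∀ R : List (RTuple V),
      ((generate G Sr j R).mean fun y => weight v y.1 * (X + Y * totalSize G y.1)) ≤
        weight v R * meanWeight G Sr v ^ j *
          (X + Y * (totalSize G R + 2 * j * meanSize G Sr)) := by
  induction j with
  | zero => intro R; rw [generate, Prog.mean_pure]; simp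
  | succ j ih =>
    intro R
    rw [generate_succ_mean G Sr j R fun R => weight v R * (X + Y * totalSize G R)]
    refine (Prog.mean_mono (Prog.always_of_forall fun x => ih (x.1 :: R))).trans ?_
    have e : ∀ x : RTuple V × ℕ, weight v (x.1 :: R) * meanWeight G Sr v ^ j *
        (X + Y * (totalSize G (x.1 :: R) + 2 * j * meanSize G Sr)) =
        weight v R * meanWeight G Sr v ^ j *
          ((if x.1.Covered {v} then 2⁻¹ else 1) *
            (X + Y * (totalSize G R + 2 * j * meanSize G Sr)) +
          Y * ((if x.1.Covered {v} then 2⁻¹ else 1) * x.1.size G)) := by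
      intro x
      rw [weight_cons, totalSize_cons, Nat.cast_add]
      ring
    simp only [e, Prog.mean_const_mul, Prog.mean_add, Prog.mean_mul_const]
    rw [← meanWeight]
    calc _ ≤ weight v R * meanWeight G Sr v ^ j *
          (meanWeight G Sr v * (X + Y * (totalSize G R + 2 * j * meanSize G Sr)) +
          Y * (meanWeight G Sr v * (2 * meanSize G Sr))) := by
            gcongr
            exact mean_weight_mul_size_le G Sr v
      _ = _ := by push_cast; ring

/-! ### The estimation phase -/

/-- The constant 14 is 8 for generation, 5 for node selection and 1 for the coverage count, each per
unit of total size. -/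
theorem estimateLoop_succ_expectedTime_le (G : Network V) (Sr : Finset V) (k : ℕ) (N δ : ℝ)
    (rounds i : ℕ) (R : List (RTuple V)) (hR : ∀ T ∈ R, T.verts.Nodup)
    (hlen : R.length = roundSize (Fintype.card V) k N δ i) (hk : k ≤ Fintype.card V)
    (hn : 1 ≤ Fintype.card V) :
    (estimateLoop G Sr k N δ (rounds + 1) (i + 1) R).expectedTime ≤
      (generate G Sr (roundSize (Fintype.card V) k N δ (i + 1) -
        roundSize (Fintype.card V) k N δ i) R).mean fun y =>
          14 * (Fintype.card V + totalSize G y.1) + failInd k N δ (i + 1) y.1 *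
            (estimateLoop G Sr k N δ rounds (i + 2) y.1).expectedTime := by
  have hM : ⌊lam (Fintype.card V) k N δ / (Fintype.card V / 2 ^ (i + 1)) + 1⌋₊ =
      roundSize (Fintype.card V) k N δ (i + 1) := by
    rw [roundSize, if_neg (Nat.succ_ne_zero i)]
  rw [estimateLoop]
  simp only [Prog.expectedTime_tick_bind, Prog.expectedTime_bind (generate _ _ _ _),
    Prog.expectedTime_det_bind]
  rw [hM, hlen, ← Prog.mean_const (generate G Sr (roundSize (Fintype.card V) k N δ (i + 1) -
        roundSize (Fintype.card V) k N δ i) R) ((1 : ℕ) : ℝ≥0∞), ← Prog.mean_add]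
  refine Prog.mean_mono ((generate_always G Sr _ R hR).mono ?_)
  rintro ⟨R', t⟩ ⟨h1, h2, h3⟩
  simp only at h1 h2 h3 ⊢
  have h4 := nodeSelection_cost G R' k
  have h5 := nodeSelection_length (Finset.univ : Finset V).toList R' k
  have h6 := length_add_sum_verts_le G R'
  have h7 : (coverage (nodeSelection Finset.univ.toList R' k).1 R').2 ≤ 2 * k + totalSize G R' := by
    simp only [coverage]
    omega
  have hrest : (if (1 + δ) * (Fintype.card V / 2 ^ (i + 1) : ℝ) ≤
      Fintype.card V * (coverage (nodeSelection Finset.univ.toList R' k).1 R').1 /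
        (lam (Fintype.card V) k N δ / (Fintype.card V / 2 ^ (i + 1)))
      then (pure (Fintype.card V * (coverage (nodeSelection Finset.univ.toList R' k).1 R').1 /
        (lam (Fintype.card V) k N δ / (Fintype.card V / 2 ^ (i + 1)) * (1 + δ))) : Prog ℝ)
      else estimateLoop G Sr k N δ rounds (i + 1 + 1) R').expectedTime =
      failInd k N δ (i + 1) R' * (estimateLoop G Sr k N δ rounds (i + 2) R').expectedTime := by
    by_cases hc : (1 + δ) * (Fintype.card V / 2 ^ (i + 1) : ℝ) ≤
      Fintype.card V * (coverage (nodeSelection Finset.univ.toList R' k).1 R').1 /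
        (lam (Fintype.card V) k N δ / (Fintype.card V / 2 ^ (i + 1)))
    · rw [if_pos hc, failInd, if_neg (by rw [RoundFails]; simp only [hc]; simp),
        Prog.expectedTime_pure, zero_mul]
    · rw [if_neg hc, failInd, if_pos (show RoundFails V k N δ (i + 1) R' from Or.inr hc), one_mul]
  rw [hrest, ← add_assoc, ← add_assoc, ← add_assoc]
  refine add_le_add_left ?_ _
  norm_cast
  omega

/-- Round i + 1 is charged to the failure of round i alone, so no joint failure probabilities occur.
Round 0 is fictitious: it has no R-tuples and always fails. -/
theorem estimateLoop_expectedTime_le (G : Network V) (Sr : Finset V) (k : ℕ) (N δ : ℝ)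
    (hk : k ≤ Fintype.card V) (hn : 1 ≤ Fintype.card V) (β : ℕ → ℝ≥0∞)
    (hβ : ∀ i X Y, ((generate G Sr (roundSize (Fintype.card V) k N δ i) []).mean fun y =>
      failInd k N δ i y.1 * (X + Y * totalSize G y.1)) ≤
        β i * (X + Y * (2 * roundSize (Fintype.card V) k N δ i * meanSize G Sr)))
    (rounds : ℕ) :
    ∀ i, ((generate G Sr (roundSize (Fintype.card V) k N δ i) []).mean fun y =>
      failInd k N δ i y.1 * (estimateLoop G Sr k N δ rounds (i + 1) y.1).expectedTime) ≤
        ∑ r ∈ Finset.range rounds, β (i + r) * (14 * (Fintype.card V +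
          2 * roundSize (Fintype.card V) k N δ (i + r + 1) * meanSize G Sr)) := by
  induction rounds with
  | zero => intro i; simp [estimateLoop, Prog.expectedTime_pure, Prog.mean_const]
  | succ rounds ih =>
    intro i
    set M := roundSize (Fintype.card V) k N δ
    have hM : M i + (M (i + 1) - M i) = M (i + 1) :=
      Nat.add_sub_cancel' (roundSize_mono _ _ _ _ i)
    have hstep : ((generate G Sr (M i) []).mean fun y => failInd k N δ i y.1 *
        (estimateLoop G Sr k N δ (rounds + 1) (i + 1) y.1).expectedTime) ≤
        (generate G Sr (M i) []).mean fun y =>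
          failInd k N δ i y.1 * ((14 * Fintype.card V +
            14 * ((M (i + 1) - M i : ℕ) * meanSize G Sr)) + 14 * totalSize G y.1) +
          (generate G Sr (M (i + 1) - M i) y.1).mean fun z => failInd k N δ (i + 1) z.1 *
            (estimateLoop G Sr k N δ rounds (i + 2) z.1).expectedTime := by
      refine Prog.mean_mono ((generate_always G Sr (M i) [] (by simp)).mono ?_)
      rintro ⟨R, t⟩ ⟨h1, h2, -⟩
      rw [List.length_nil, zero_add] at h1
      refine (mul_le_mul_right (estimateLoop_succ_expectedTime_le G Sr k N δ rounds i R h2 h1 hk hn)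
        _).trans ?_
      rw [Prog.mean_add, Prog.mean_const_mul, Prog.mean_add, Prog.mean_const,
        generate_mean_totalSize, mul_add]
      -- The earlier failure indicator is dropped from the later rounds, which keep the indicator of
      -- round i + 1.
      refine add_le_add (le_of_eq ?_) (mul_le_of_le_one_left zero_le (failInd_le_one _ _ _ _ _))
      ring
    refine hstep.trans ?_
    rw [Prog.mean_add, ← generate_add_mean G Sr (M i) (M (i + 1) - M i) (fun R =>
      failInd k N δ (i + 1) R * (estimateLoop G Sr k N δ rounds (i + 2) R).expectedTime), hM,
      Finset.sum_range_succ', add_comm]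
    refine add_le_add ?_ ?_
    · refine (ih (i + 1)).trans_eq (Finset.sum_congr rfl fun r _ => ?_)
      rw [show i + 1 + r = i + (r + 1) by omega]
    · refine (hβ i _ _).trans ?_
      rw [add_zero]
      gcongr
      -- The new R-tuples are independent of the failure of round i and count once. Only the old
      -- ones suffer the factor 2.
      calc _ = (14 : ℝ≥0∞) * (Fintype.card V + ((M (i + 1) - M i : ℕ) + 2 * M i : ℝ≥0∞) *
            meanSize G Sr) := by ring
        _ ≤ _ := by
          gcongr
          norm_cast
          omega

theorem estimateLoop_mean_inv_le (G : Network V) (Sr : Finset V) (k : ℕ) (N δ : ℝ) (hδ : 0 < δ)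
    (β : ℕ → ℝ≥0∞)
    (hβ : ∀ i, ((generate G Sr (roundSize (Fintype.card V) k N δ i) []).mean fun y =>
      failInd k N δ i y.1) ≤ β i) (rounds : ℕ) :
    ∀ i, (Fintype.card V ≤ 2 ^ (i + rounds + 1)) →
      ((generate G Sr (roundSize (Fintype.card V) k N δ i) []).mean fun y =>
        failInd k N δ i y.1 * (estimateLoop G Sr k N δ rounds (i + 1) y.1).mean fun z =>
          ENNReal.ofReal z.1⁻¹) ≤
        ∑ r ∈ Finset.range (rounds + 1),
          β (i + r) * ENNReal.ofReal (2 ^ (i + r + 1) / Fintype.card V) := by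
  have hn : (0 : ℝ) < Fintype.card V := by exact_mod_cast Fintype.card_pos
  induction rounds with
  | zero =>
    intro i hi
    -- The default estimate 1 is treated as the threshold of one further round, since n ≤ 2^(i+1)
    -- here.
    simp only [estimateLoop, Prog.mean_pure, Prog.mean_mul_const, zero_add, Finset.range_one,
      Finset.sum_singleton, add_zero] at hi ⊢
    gcongr
    · exact hβ i
    · rw [inv_one, le_div_iff₀ hn]
      exact_mod_cast (by simpa using hi)
  | succ rounds ih =>
    intro i hi
    set M := roundSize (Fintype.card V) k N δ with hMdef
    have hM : M i + (M (i + 1) - M i) = M (i + 1) :=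
      Nat.add_sub_cancel' (roundSize_mono _ _ _ _ i)
    have hM' : ⌊lam (Fintype.card V) k N δ / (Fintype.card V / 2 ^ (i + 1)) + 1⌋₊ = M (i + 1) := by
      rw [hMdef, roundSize, if_neg (Nat.succ_ne_zero i)]
    have hstep : ((generate G Sr (M i) []).mean fun y => failInd k N δ i y.1 *
        (estimateLoop G Sr k N δ (rounds + 1) (i + 1) y.1).mean fun z => ENNReal.ofReal z.1⁻¹) ≤
        (generate G Sr (M i) []).mean fun y =>
          failInd k N δ i y.1 * ENNReal.ofReal (2 ^ (i + 1) / Fintype.card V) +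
          (generate G Sr (M (i + 1) - M i) y.1).mean fun z => failInd k N δ (i + 1) z.1 *
            (estimateLoop G Sr k N δ rounds (i + 2) z.1).mean fun z => ENNReal.ofReal z.1⁻¹ := by
      refine Prog.mean_mono ((generate_always G Sr (M i) [] (by simp)).mono ?_)
      rintro ⟨R, t⟩ ⟨h1, h2, -⟩
      rw [List.length_nil, zero_add] at h1
      simp only at h1 ⊢
      have hle : ((estimateLoop G Sr k N δ (rounds + 1) (i + 1) R).mean fun z =>
          ENNReal.ofReal z.1⁻¹) ≤ ENNReal.ofReal (2 ^ (i + 1) / Fintype.card V) +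
          (generate G Sr (M (i + 1) - M i) R).mean fun z => failInd k N δ (i + 1) z.1 *
            (estimateLoop G Sr k N δ rounds (i + 2) z.1).mean fun z => ENNReal.ofReal z.1⁻¹ := by
        rw [estimateLoop]
        simp only [Prog.mean_bind, Prog.mean_tick, Prog.mean_det]
        rw [hM', h1, ← Prog.mean_const (generate G Sr (M (i + 1) - M i) R)
          (ENNReal.ofReal (2 ^ (i + 1) / Fintype.card V)), ← Prog.mean_add]
        refine Prog.mean_mono (Prog.always_of_forall ?_)
        rintro ⟨R', t'⟩
        simp only
        by_cases hc : (1 + δ) * (Fintype.card V / 2 ^ (i + 1) : ℝ) ≤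
            Fintype.card V * (coverage (nodeSelection Finset.univ.toList R' k).1 R').1 /
              (lam (Fintype.card V) k N δ / (Fintype.card V / 2 ^ (i + 1)))
        · rw [if_pos hc, Prog.mean_pure]
          -- The return test makes the returned value at least the threshold x of the round.
          refine le_add_right (ENNReal.ofReal_le_ofReal ?_)
          rw [← div_div]
          have hx : (0 : ℝ) < Fintype.card V / 2 ^ (i + 1) := by positivity
          rw [← inv_div (Fintype.card V : ℝ)]
          refine inv_anti₀ hx ?_
          rw [le_div_iff₀ (by linarith)]
          linarith
        · rw [if_neg hc, failInd, if_pos (show RoundFails V k N δ (i + 1) R' from Or.inr hc), one_mul]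
          exact le_add_left le_rfl
      refine (mul_le_mul_right hle _).trans ?_
      rw [mul_add]
      exact add_le_add_right (mul_le_of_le_one_left zero_le (failInd_le_one _ _ _ _ _)) _
    refine hstep.trans ?_
    rw [Prog.mean_add, ← generate_add_mean G Sr (M i) (M (i + 1) - M i) (fun R =>
      failInd k N δ (i + 1) R * (estimateLoop G Sr k N δ rounds (i + 2) R).mean fun z =>
        ENNReal.ofReal z.1⁻¹), hM, Finset.sum_range_succ', add_comm, Prog.mean_mul_const]
    refine add_le_add ?_ ?_
    · refine (ih (i + 1) (by rwa [show i + 1 + rounds + 1 = i + (rounds + 1) + 1 by omega])).trans_eq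
        (Finset.sum_congr rfl fun r _ => ?_)
      rw [show i + 1 + r = i + (r + 1) by omega]
    · rw [add_zero]
      gcongr
      exact hβ i

/-- Markov's inequality in pointwise form. Since x_i·l_i = λ, failure means coverage below (1+δ)λ/n
in every round, hence at most that many R-tuples covered by v. -/
theorem failInd_le_weight (k : ℕ) (N δ : ℝ) (hk : 1 ≤ k) (i : ℕ) (hi : i ≠ 0) (v : V)
    (hlam : 0 < lam (Fintype.card V) k N δ)
    (R : List (RTuple V)) (hR : ∀ T ∈ R, T.verts.Nodup) :
    failInd k N δ i R ≤
      ENNReal.ofReal (2 ^ ((1 + δ) * (lam (Fintype.card V) k N δ / Fintype.card V))) *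
        weight v R := by
  have hn : (0 : ℝ) < Fintype.card V := by exact_mod_cast Fintype.card_pos
  rw [failInd]
  split_ifs with hf
  swap
  · exact zero_le
  have hcov := nodeSelection_coverage (Finset.univ : Finset V).toList R k hk hR (v := v) (by simp)
  have hlt := hf.resolve_left hi
  rw [not_le, div_lt_iff₀ (by positivity)] at hlt
  have hlt' : ((R.countP fun T => decide (T.Covered {v}) : ℕ) : ℝ) ≤
      (1 + δ) * (lam (Fintype.card V) k N δ / Fintype.card V) := by
    refine le_trans (Nat.cast_le.2 hcov) ?_
    rw [mul_div_assoc', le_div_iff₀ hn]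
    refine le_of_lt (lt_of_eq_of_lt (mul_comm _ _) (hlt.trans_eq ?_))
    field_simp
  have hw : weight v R =
      ENNReal.ofReal (2 ^ (-((R.countP fun T => decide (T.Covered {v}) : ℕ) : ℝ))) := by
    rw [weight, Real.rpow_neg (by norm_num), Real.rpow_natCast, ENNReal.ofReal_inv_of_pos (by positivity),
      ENNReal.ofReal_pow (by norm_num), ENNReal.inv_pow]
    norm_num
  rw [hw, ← ENNReal.ofReal_mul (by positivity), ← Real.rpow_add (by norm_num)]
  refine ENNReal.one_le_ofReal.2 (Real.one_le_rpow (by norm_num) ?_)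
  linarith

end

section

variable {V : Type} [Fintype V] [DecidableEq V] [Nonempty V]

/-! ### Probability that a round fails -/

/-- An optimal set for OPT_1 has at most one node. If it is empty, any node may be added. -/
theorem exists_prob_covered_ge (G : Network V) (Sr : Finset V) :
    ∃ v, ENNReal.ofReal (OPT G Sr 1 / Fintype.card V) ≤
      (randomRTuple G Sr).mean fun y => if y.1.Covered {v} then 1 else 0 := by
  have hn : (0 : ℝ) < Fintype.card V := by exact_mod_cast Fintype.card_pos
  obtain ⟨S, hS, hO⟩ := Finset.exists_mem_eq_sup' (s := Finset.univ.filter fun S : Finset V =>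
    S.card ≤ 1) ⟨∅, by simp⟩ (f G Sr)
  obtain ⟨v, hv⟩ := Finset.card_le_one_iff_subset_singleton.1 (Finset.mem_filter.1 hS).2
  refine ⟨v, ?_⟩
  have hO' : OPT G Sr 1 = f G Sr S := hO
  rw [hO', ENNReal.ofReal_div_of_pos hn, ENNReal.ofReal_natCast, ENNReal.div_eq_inv_mul]
  refine (le_prob_covered G Sr S).trans (Prog.mean_mono (Prog.always_of_forall fun y => ?_))
  by_cases h : y.1.Covered S
  · have : y.1.Covered {v} := h.imp id fun ⟨w, hw, hwS⟩ => ⟨w, hw, hv hwS⟩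
    simp [h, this]
  · simp [h]

theorem meanWeight_le (G : Network V) (Sr : Finset V) (v : V) {p : ℝ}
    (hp : ENNReal.ofReal p ≤ (randomRTuple G Sr).mean fun y => if y.1.Covered {v} then 1 else 0) :
    meanWeight G Sr v ≤ ENNReal.ofReal (Real.exp (-(p / 2))) := by
  rcases lt_or_ge p 0 with hp0 | hp0
  · refine le_trans (le_trans le_self_add (meanWeight_add G Sr v).le) ?_
    exact ENNReal.one_le_ofReal.2 (Real.one_le_exp (by linarith))
  have h1 : meanWeight G Sr v + ENNReal.ofReal (p / 2) ≤ 1 := by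
    rw [← meanWeight_add G Sr v]
    gcongr
    rw [div_eq_inv_mul, ENNReal.ofReal_mul (by norm_num), ENNReal.ofReal_inv_of_pos (by norm_num)]
    simpa using mul_le_mul_right hp 2⁻¹
  have h2 : meanWeight G Sr v ≤ 1 - ENNReal.ofReal (p / 2) :=
    ENNReal.le_sub_of_add_le_right ENNReal.ofReal_ne_top h1
  refine h2.trans ?_
  rw [← ENNReal.ofReal_one, ← ENNReal.ofReal_sub _ (by positivity)]
  exact ENNReal.ofReal_le_ofReal (by linarith [Real.add_one_le_exp (-(p / 2))])

/-- Bound of the probability that round `i` fails. -/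
noncomputable def failBound (n k : ℕ) (N δ p : ℝ) (i : ℕ) : ℝ :=
  if 0 < lam n k N δ ∧ i ≠ 0 then
    min 1 (2 ^ ((1 + δ) * (lam n k N δ / n)) * Real.exp (-(p / 2) * roundSize n k N δ i))
  else 1

theorem failBound_nonneg (n k : ℕ) (N δ p : ℝ) (i : ℕ) : 0 ≤ failBound n k N δ p i := by
  rw [failBound]; split_ifs <;> positivity

theorem failBound_le_one (n k : ℕ) (N δ p : ℝ) (i : ℕ) : failBound n k N δ p i ≤ 1 := by
  rw [failBound]; split_ifs
  · exact min_le_left _ _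
  · exact le_rfl

theorem failInd_mean_le (G : Network V) (Sr : Finset V) (k : ℕ) (N δ : ℝ) (hk : 1 ≤ k) (i : ℕ)
    (X Y : ℝ≥0∞) :
    ((generate G Sr (roundSize (Fintype.card V) k N δ i) []).mean fun y =>
      failInd k N δ i y.1 * (X + Y * totalSize G y.1)) ≤
      ENNReal.ofReal (failBound (Fintype.card V) k N δ (OPT G Sr 1 / Fintype.card V) i) *
        (X + Y * (2 * roundSize (Fintype.card V) k N δ i * meanSize G Sr)) := by
  set M := roundSize (Fintype.card V) k N δ i
  have hone : ((generate G Sr M []).mean fun y =>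
      failInd k N δ i y.1 * (X + Y * totalSize G y.1)) ≤ X + Y * (2 * M * meanSize G Sr) := by
    refine (Prog.mean_mono (Prog.always_of_forall fun y =>
      mul_le_of_le_one_left zero_le (failInd_le_one k N δ i y.1))).trans ?_
    rw [Prog.mean_add, Prog.mean_const, Prog.mean_const_mul, generate_mean_totalSize,
      totalSize_nil, Nat.cast_zero, zero_add]
    have : (M : ℝ≥0∞) ≤ 2 * M := by norm_cast; omega
    gcongr
  rw [failBound]
  split_ifs with h
  swap
  · simpa using hone
  -- When the exponential bound exceeds 1, the trivial bound on the failure indicator is used.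
  rcases min_cases (1 : ℝ) (2 ^ ((1 + δ) * (lam (Fintype.card V) k N δ / Fintype.card V)) *
    Real.exp (-(OPT G Sr 1 / Fintype.card V / 2) * M)) with ⟨e, -⟩ | ⟨e, -⟩
  · rw [e]; simpa using hone
  rw [e]
  obtain ⟨v, hv⟩ := exists_prob_covered_ge G Sr
  calc _ ≤ (generate G Sr M []).mean fun y =>
        ENNReal.ofReal (2 ^ ((1 + δ) * (lam (Fintype.card V) k N δ / Fintype.card V))) *
          (weight v y.1 * (X + Y * totalSize G y.1)) := by
        refine Prog.mean_mono ((generate_always G Sr M [] (by simp)).mono ?_)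
        rintro y ⟨-, h2, -⟩
        rw [← mul_assoc]
        gcongr
        exact failInd_le_weight k N δ hk i h.2 v h.1 y.1 h2
    _ ≤ ENNReal.ofReal (2 ^ ((1 + δ) * (lam (Fintype.card V) k N δ / Fintype.card V))) *
          (ENNReal.ofReal (Real.exp (-(OPT G Sr 1 / Fintype.card V / 2))) ^ M *
          (X + Y * (2 * M * meanSize G Sr))) := by
        rw [Prog.mean_const_mul]
        gcongr
        refine (generate_mean_weight_le G Sr v X Y M []).trans ?_
        rw [totalSize_nil, Nat.cast_zero, zero_add, weight, List.countP_nil, pow_zero, one_mul]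
        gcongr
        exact meanWeight_le G Sr v hv
    _ = _ := by
        rw [← mul_assoc, ← ENNReal.ofReal_pow (by positivity), ← Real.exp_nat_mul,
          ← ENNReal.ofReal_mul (by positivity), mul_comm (M : ℝ)]

/-! ### Numerical estimates -/

theorem sum_min_inv_le {x : ℝ} (hx : 0 < x) (L : ℕ) :
    ∑ r ∈ Finset.range L, min (x * 2 ^ r) (x * 2 ^ r)⁻¹ ≤ 3 := by
  -- The invariant follows the two geometric series: while y = x·2^L ≤ 1 the sum is at most the next
  -- term y, afterwards at most 3 - 2/y. At the crossing 1/2 < y ≤ 1, and the step amounts to (2y -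
  -- 1)(y - 1) ≤ 0.
  have key : ∀ L : ℕ, ∑ r ∈ Finset.range L, min (x * 2 ^ r) (x * 2 ^ r)⁻¹ ≤
      if x * 2 ^ L ≤ 1 then x * 2 ^ L else 3 - 2 * (x * 2 ^ L)⁻¹ := by
    intro L
    induction L with
    | zero =>
      simp only [Finset.range_zero, Finset.sum_empty, pow_zero, mul_one]
      split_ifs with h
      · exact hx.le
      · have : x⁻¹ ≤ 1 := inv_le_one_of_one_le₀ (by linarith)
        linarith
    | succ L ih =>
      rw [Finset.sum_range_succ]
      have hy : 0 < x * 2 ^ L := by positivity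
      have e : x * 2 ^ (L + 1) = 2 * (x * 2 ^ L) := by ring
      rw [e]
      generalize x * 2 ^ L = y at *
      have e2 : (2 * y)⁻¹ = y⁻¹ / 2 := by rw [mul_inv]; ring
      rw [e2]
      have h1 := min_le_left y y⁻¹
      have h2 := min_le_right y y⁻¹
      split_ifs with h
      · rw [if_pos (by linarith)] at ih
        linarith
      · split_ifs at ih with h'
        · have : y⁻¹ ≤ 3 - 2 * y := by
            rw [inv_le_iff_one_le_mul₀ hy]
            nlinarith
          linarith
        · linarith
  refine (key L).trans ?_
  split_ifs with h
  · linarith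
  · have : 0 < (x * 2 ^ L)⁻¹ := by positivity
    linarith

/-- Uniform bound of `z² P` for the failure probability `P` of a round and the ratio `z` of the
optimum and the threshold of the round. -/
noncomputable def tailConst (N δ : ℝ) : ℝ :=
  4 * (2 ^ (2 / N) : ℝ) ^ 2 + 4 + 64 * (1 + δ) ^ 2 + 128 / ((2 + δ) / δ ^ 2 * Real.log 2) ^ 2

/-- The square yields decay like 1/z, even after one factor z is spent on the cost of the round. The
summands of `tailConst` belong to the cases: n bounded because the argument of the logarithm in λ is
below 2; r = 0 or O ≤ 1, where z ≤ 2; z ≤ 8(1+δ); and the exponential tail. -/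
theorem sq_mul_failBound_le {n k : ℕ} {N δ O : ℝ} (hN : 0 < N) (hδ : 0 < δ) (hn : 2 ≤ n)
    (hkn : k ≤ n) (hO : O ≤ n) {r : ℕ} (hr : 2 ^ r ≤ n) :
    (max O 1 * 2 ^ (r + 1) / n) ^ 2 * failBound n k N δ (O / n) r ≤ tailConst N δ := by
  have hn0 : (0 : ℝ) < n := by positivity
  have hn2 : (2 : ℝ) ≤ n := by exact_mod_cast hn
  have hr' : (2 : ℝ) ^ r ≤ n := by exact_mod_cast hr
  have hlog2 := Real.log_pos one_lt_two
  set b : ℝ := (2 + δ) / δ ^ 2 * Real.log 2 with hb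
  have hb0 : 0 < b := by positivity
  set z : ℝ := max O 1 * 2 ^ (r + 1) / n with hz
  have hz0 : 0 ≤ z := by positivity
  have hA : 0 ≤ 4 * (2 ^ (2 / N) : ℝ) ^ 2 := by positivity
  have hB : 0 ≤ 64 * (1 + δ) ^ 2 := by positivity
  have hC : 0 ≤ 128 / b ^ 2 := by positivity
  have hP0 := failBound_nonneg n k N δ (O / n) r
  have hP1 := failBound_le_one n k N δ (O / n) r
  have easy : z ^ 2 * failBound n k N δ (O / n) r ≤ z ^ 2 :=
    mul_le_of_le_one_right (sq_nonneg _) hP1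
  have small : ∀ y : ℝ, max O 1 * 2 ^ (r + 1) ≤ y * n → z ≤ y := fun y hy =>
    (div_le_iff₀ hn0).2 hy
  rw [tailConst]
  have hch : (1 : ℝ) ≤ n.choose k := by exact_mod_cast Nat.choose_pos hkn
  have hlogb : 1 ≤ Real.logb 2 n := by
    rw [Real.le_logb_iff_rpow_le one_lt_two hn0]; simpa using hn2
  by_cases hsm : N * n.choose k * Real.logb 2 n < 2
  · have h1 : Real.logb 2 n ≤ 2 / N := by
      rw [le_div_iff₀ hN]
      nlinarith [mul_le_mul_of_nonneg_left hch hN.le, mul_nonneg hN.le (zero_le_one.trans hlogb)]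
    have h2 : (n : ℝ) ≤ 2 ^ (2 / N) := (Real.logb_le_iff_le_rpow one_lt_two hn0).1 h1
    have h3 : z ≤ 2 * 2 ^ (2 / N) := by
      refine small _ ?_
      have : max O 1 ≤ n := max_le hO (by linarith)
      calc max O 1 * 2 ^ (r + 1) = 2 * (max O 1 * 2 ^ r) := by ring
        _ ≤ 2 * (n * n) := by gcongr
        _ ≤ 2 * 2 ^ (2 / N) * n := by nlinarith
    have h4 : z ^ 2 ≤ (2 * 2 ^ (2 / N)) ^ 2 := by gcongr
    nlinarith
  push Not at hsm
  have hlam : lam n k N δ / n = (2 + δ) / δ ^ 2 * Real.log (N * n.choose k * Real.logb 2 n) := by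
    rw [lam]; field_simp
  have hmu : b ≤ lam n k N δ / n := by
    rw [hlam, hb]
    gcongr
  have hlampos : 0 < lam n k N δ := by
    have := hb0.trans_le hmu
    by_contra h
    push Not at h
    linarith [div_nonpos_of_nonpos_of_nonneg h hn0.le]
  by_cases hr0 : r = 0
  · have : z ≤ 2 := by
      refine small _ ?_
      have : max O 1 ≤ n := max_le hO (by linarith)
      rw [hr0, zero_add, pow_one]; linarith
    nlinarith
  rcases le_total O 1 with hO1 | hO1
  · have : z ≤ 2 := by
      refine small _ ?_
      rw [max_eq_right hO1, pow_succ]; linarith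
    nlinarith
  rcases le_or_gt z (8 * (1 + δ)) with hzs | hzs
  · have : z ^ 2 ≤ (8 * (1 + δ)) ^ 2 := by gcongr
    nlinarith
  have hM : lam n k N δ / n * 2 ^ r ≤ roundSize n k N δ r := by
    rw [roundSize, if_neg hr0]
    have := Nat.lt_floor_add_one (lam n k N δ / (n / 2 ^ r) + 1)
    have e : lam n k N δ / (n / 2 ^ r) = lam n k N δ / n * 2 ^ r := by field_simp
    rw [← e]
    linarith
  have hexp : failBound n k N δ (O / n) r ≤ Real.exp (-(b * z / 8)) := by
    rw [failBound, if_pos ⟨hlampos, hr0⟩]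
    refine (min_le_right _ _).trans ?_
    rw [Real.rpow_def_of_pos two_pos, ← Real.exp_add]
    refine Real.exp_le_exp.2 ?_
    set μ := lam n k N δ / n
    have hμ0 : 0 < μ := hb0.trans_le hmu
    have h1 : Real.log 2 * ((1 + δ) * μ) ≤ (1 + δ) * μ :=
      mul_le_of_le_one_left (by positivity) (by linarith [Real.log_two_lt_d9])
    have h2 : O / n / 2 * (μ * 2 ^ r) ≤ O / n / 2 * roundSize n k N δ r := by gcongr
    have h3 : O / n / 2 * (μ * 2 ^ r) = μ * z / 4 := by
      rw [hz, max_eq_left hO1, pow_succ]; ring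
    -- Beyond z = 8(1+δ), the factor from Markov's inequality uses up at most half of the exponent
    -- μz/4.
    have h4 : (1 + δ) * μ ≤ μ * z / 8 := by nlinarith
    have h5 : b * z ≤ μ * z := by gcongr
    linarith
  have hy : z ^ 2 * Real.exp (-(b * z / 8)) ≤ 128 / b ^ 2 := by
    have h1 := Real.quadratic_le_exp_of_nonneg (show 0 ≤ b * z / 8 by positivity)
    rw [Real.exp_neg, ← div_eq_mul_inv, div_le_iff₀ (Real.exp_pos _)]
    have h2 : (b * z / 8) ^ 2 / 2 ≤ Real.exp (b * z / 8) := by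
      have : 0 ≤ b * z / 8 := by positivity
      linarith
    calc z ^ 2 = 128 / b ^ 2 * ((b * z / 8) ^ 2 / 2) := by field_simp; ring
      _ ≤ _ := by gcongr
  have := mul_le_mul_of_nonneg_left hexp (sq_nonneg z)
  linarith

theorem sum_failBound_le {n k : ℕ} {N δ O : ℝ} (hN : 0 < N) (hδ : 0 < δ) (hn : 2 ≤ n)
    (hkn : k ≤ n) (hO : O ≤ n) {L : ℕ} (hL : 2 ^ L ≤ n) :
    ∑ r ∈ Finset.range (L + 1), failBound n k N δ (O / n) r * (max O 1 * 2 ^ (r + 1) / n) ≤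
      3 * tailConst N δ := by
  have hn0 : (0 : ℝ) < n := by positivity
  have hx : 0 < max O 1 * 2 / n := by
    have : 0 < max O 1 := lt_max_of_lt_right one_pos
    positivity
  have hT : 1 ≤ tailConst N δ := by
    rw [tailConst]
    have h1 : 0 ≤ 4 * (2 ^ (2 / N) : ℝ) ^ 2 := by positivity
    have h2 : 0 ≤ 64 * (1 + δ) ^ 2 := by positivity
    have h3 : 0 ≤ 128 / ((2 + δ) / δ ^ 2 * Real.log 2) ^ 2 := by positivity
    linarith
  calc _ ≤ ∑ r ∈ Finset.range (L + 1), tailConst N δ *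
        min (max O 1 * 2 / n * 2 ^ r) (max O 1 * 2 / n * 2 ^ r)⁻¹ := by
        refine Finset.sum_le_sum fun r hr => ?_
        have hr' : 2 ^ r ≤ n :=
          (Nat.pow_le_pow_right two_pos (Nat.lt_succ_iff.1 (Finset.mem_range.1 hr))).trans hL
        have h := sq_mul_failBound_le (k := k) hN hδ hn hkn hO hr'
        have h1 := failBound_le_one n k N δ (O / n) r
        have e : max O 1 * 2 ^ (r + 1) / n = max O 1 * 2 / n * 2 ^ r := by ring
        rw [e] at h ⊢
        have hz : 0 < max O 1 * 2 / n * 2 ^ r := by positivity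
        generalize max O 1 * 2 / n * 2 ^ r = z at *
        -- With P the failure bound, P·z ≤ Tz comes from P ≤ 1 ≤ T, and P·z ≤ T/z from the bound of
        -- z²P.
        rw [mul_min_of_nonneg _ _ (by linarith)]
        refine le_min ?_ ?_
        · exact mul_le_mul_of_nonneg_right (h1.trans hT) hz.le
        · rw [← div_eq_mul_inv, le_div_iff₀ hz]
          linarith
    _ ≤ _ := by
        rw [← Finset.mul_sum]
        have := sum_min_inv_le hx (L + 1)
        nlinarith

end

section

/-! ### The running time of the whole algorithm -/

theorem half_le_log {n : ℕ} (hn : 2 ≤ n) : 1 / 2 ≤ Real.log n := by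
  have h : Real.log 2 ≤ Real.log n := Real.log_le_log two_pos (by exact_mod_cast hn)
  linarith [Real.log_two_gt_d9]

theorem log_choose_le {n k : ℕ} (hkn : k ≤ n) :
    Real.log (n.choose k) ≤ k * Real.log n := by
  rw [← Real.log_pow]
  refine Real.log_le_log (by exact_mod_cast Nat.choose_pos hkn) ?_
  exact_mod_cast Nat.choose_le_pow n k

theorem lam_le {n k : ℕ} {N δ : ℝ} (hN : 0 < N) (hδ : 0 < δ) (hn : 2 ≤ n) (hk : 1 ≤ k)
    (hkn : k ≤ n) :
    lam n k N δ ≤ (2 + δ) / δ ^ 2 * (2 * N + 2) * (n * (k * Real.log n)) := by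
  have hn2 : (2 : ℝ) ≤ n := by exact_mod_cast hn
  have hn0 : (0 : ℝ) < n := by linarith
  have hk1 : (1 : ℝ) ≤ k := by exact_mod_cast hk
  have hlog := half_le_log hn
  have hch : (1 : ℝ) ≤ n.choose k := by exact_mod_cast Nat.choose_pos hkn
  have hlogb : 1 ≤ Real.logb 2 n := by
    rw [Real.le_logb_iff_rpow_le one_lt_two hn0]; simpa using hn2
  have hlogb' : Real.logb 2 n ≤ n := by
    rw [Real.logb_le_iff_le_rpow one_lt_two hn0, Real.rpow_natCast]
    exact_mod_cast Nat.lt_two_pow_self.le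
  have h1 : Real.log (N * n.choose k * Real.logb 2 n) ≤ (2 * N + 2) * (k * Real.log n) := by
    rw [Real.log_mul (by positivity) (by positivity), Real.log_mul (by positivity) (by positivity)]
    have e1 : Real.log N ≤ N := Real.log_le_self hN.le
    have e2 := log_choose_le hkn
    have e3 : Real.log (Real.logb 2 n) ≤ Real.log n := Real.log_le_log (by linarith) hlogb'
    have e4 : Real.log n ≤ k * Real.log n := le_mul_of_one_le_left (by linarith) hk1
    have e5 : N * (1 / 2) ≤ N * (k * Real.log n) :=
      mul_le_mul_of_nonneg_left (hlog.trans e4) hN.le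
    linarith
  calc lam n k N δ = (2 + δ) / δ ^ 2 * n * Real.log (N * n.choose k * Real.logb 2 n) := by
        rw [lam]; ring
    _ ≤ (2 + δ) / δ ^ 2 * n * ((2 * N + 2) * (k * Real.log n)) := by gcongr
    _ = _ := by ring

theorem lStar_le {n k : ℕ} {N c δ₁ δ₂ x : ℝ} (hN : 0 < N) (hc : 0 < c) (hn : 2 ≤ n) (hk : 1 ≤ k)
    (hkn : k ≤ n) (hx : 0 < x) (h0 : 0 < δ₂) (h1 : δ₂ ≤ 1) (hδ₁ : c * δ₂ ≤ δ₁)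
    (hδ : c * δ₂ ≤ δ₂ - (1 - Real.exp (-1)) * δ₁) :
    lStar n k N δ₁ δ₂ x ≤ (10 * N + 3) / c ^ 2 * (n * (k * Real.log n)) / δ₂ ^ 2 * x⁻¹ := by
  have hn2 : (2 : ℝ) ≤ n := by exact_mod_cast hn
  have hn0 : (0 : ℝ) < n := by linarith
  have hk1 : (1 : ℝ) ≤ k := by exact_mod_cast hk
  have hlog := half_le_log hn
  have hch : (1 : ℝ) ≤ n.choose k := by exact_mod_cast Nat.choose_pos hkn
  have hcd : 0 < c * δ₂ := by positivity
  have e1 : Real.log N ≤ N := Real.log_le_self hN.le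
  have e4 : Real.log n ≤ k * Real.log n := le_mul_of_one_le_left (by linarith) hk1
  have e5 : N * (1 / 2) ≤ N * (k * Real.log n) :=
    mul_le_mul_of_nonneg_left (hlog.trans e4) hN.le
  have hkl : 0 ≤ k * Real.log n := by linarith
  have hNkl : 0 ≤ N * (k * Real.log n) := by positivity
  have hden : ∀ d A B : ℝ, c * δ₂ ≤ d → A ≤ B → 0 ≤ B →
      n * A / (d ^ 2 * x) ≤ n * B / ((c * δ₂) ^ 2 * x) := by
    intro d A B hd hAB hB
    gcongr
  have hfin : n * ((10 * N + 3) * (k * Real.log n)) / ((c * δ₂) ^ 2 * x) =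
      (10 * N + 3) / c ^ 2 * (n * (k * Real.log n)) / δ₂ ^ 2 * x⁻¹ := by
    field_simp
  rw [← hfin, lStar]
  have hexp : Real.exp (-1) ≤ 1 := Real.exp_le_one_iff.2 (by norm_num)
  have hd1 : δ₂ - (1 - Real.exp (-1)) * δ₁ ≤ 1 := by
    have := mul_nonneg (sub_nonneg.2 hexp) (hcd.le.trans hδ₁)
    linarith
  set d := δ₂ - (1 - Real.exp (-1)) * δ₁
  have hB : 0 ≤ (10 * N + 3) * (k * Real.log n) := by positivity
  refine max_le ?_ ?_
  · have := hden δ₁ (2 * Real.log N) _ hδ₁ (by nlinarith) hB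
    rwa [show n * (2 * Real.log N) = 2 * n * Real.log N by ring] at this
  · have hA : (2 + d) * Real.log (N * n.choose k) ≤ (10 * N + 3) * (k * Real.log n) := by
      rw [Real.log_mul (by positivity) (by positivity)]
      have e2 := log_choose_le hkn
      calc (2 + d) * (Real.log N + Real.log (n.choose k))
          ≤ (2 + d) * (N + k * Real.log n) := by
            gcongr
            linarith
        _ ≤ 3 * (N + k * Real.log n) := by gcongr; linarith
        _ ≤ _ := by nlinarith
    have := hden d _ _ hδ hA hB
    rwa [show n * ((2 + d) * Real.log (N * n.choose k)) =
      (2 + d) * n * Real.log (N * n.choose k) by ring] at this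

theorem roundSize_le (n k : ℕ) (N δ : ℝ) (i : ℕ) :
    (roundSize n k N δ i : ℝ) ≤ max (lam n k N δ) 0 * 2 ^ i / n + 1 := by
  have h0 : 0 ≤ max (lam n k N δ) 0 * 2 ^ i / n := by positivity
  rw [roundSize]
  split_ifs with h
  · push_cast; linarith
  · have e : lam n k N δ / (n / 2 ^ i) ≤ max (lam n k N δ) 0 * 2 ^ i / n := by
      rw [div_div_eq_mul_div]
      gcongr
      exact le_max_left _ _
    refine (Nat.cast_le.2 (Nat.floor_le_floor (add_le_add_left e 1))).trans ?_
    exact Nat.floor_le (by linarith)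

variable {V : Type} [Fintype V] [DecidableEq V]

theorem OPT_le_card (G : Network V) (Sr : Finset V) (i : ℕ) : OPT G Sr i ≤ Fintype.card V :=
  Finset.sup'_le _ _ fun S _ => f_le_card G Sr S

theorem OPT_nonneg (G : Network V) (Sr : Finset V) (i : ℕ) : 0 ≤ OPT G Sr i :=
  (f_nonneg G Sr ∅).trans (f_le_OPT G Sr ∅ (by simp))

variable [Nonempty V]

/-- The condition m ≥ n absorbs the node terms into m/n. The maximum with 1 is needed because OPT_1
may be smaller than 1, while every R-tuple has size at least 1. -/
theorem meanSize_le (G : Network V) (Sr : Finset V) (hm : Fintype.card V ≤ G.edges.card) :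
    meanSize G Sr ≤
      ENNReal.ofReal (3 * (G.edges.card / Fintype.card V * max (OPT G Sr 1) 1)) := by
  have hn : (0 : ℝ) < Fintype.card V := by exact_mod_cast Fintype.card_pos
  have hm' : (Fintype.card V : ℝ) ≤ G.edges.card := by exact_mod_cast hm
  have hO := OPT_nonneg G Sr 1
  refine (mean_size_le G Sr).trans ?_
  rw [← ENNReal.ofReal_one, ← ENNReal.ofReal_add zero_le_one (by positivity)]
  refine ENNReal.ofReal_le_ofReal ?_
  have h1 : (1 : ℝ) ≤ G.edges.card / Fintype.card V := by rwa [le_div_iff₀ hn, one_mul]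
  have h2 : (1 : ℝ) ≤ max (OPT G Sr 1) 1 := le_max_right _ _
  have h3 : OPT G Sr 1 ≤ max (OPT G Sr 1) 1 := le_max_left _ _
  push_cast
  rw [add_div, div_self hn.ne']
  generalize (G.edges.card : ℝ) / Fintype.card V = ρ at *
  generalize max (OPT G Sr 1) 1 = O at *
  have h4 : (1 + ρ) * OPT G Sr 1 ≤ (1 + ρ) * O := by gcongr
  nlinarith

theorem estimateLoop_always_pos (G : Network V) (Sr : Finset V) (k : ℕ) (N δ : ℝ) (hδ : 0 < δ)
    (rounds : ℕ) :
    ∀ (i : ℕ) (R : List (RTuple V)),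
      (estimateLoop G Sr k N δ rounds i R).Always fun y => 0 < y.1 := by
  have hn : (0 : ℝ) < Fintype.card V := by exact_mod_cast Fintype.card_pos
  induction rounds with
  | zero =>
    intro i R
    rw [estimateLoop]
    exact Prog.always_pure one_pos
  | succ rounds ih =>
    intro i R
    rw [estimateLoop]
    refine Prog.always_tick_bind (Prog.always_bind (Prog.always_of_forall fun R' =>
      Prog.always_det_bind (Prog.always_det_bind ?_)))
    split_ifs with h
    · refine Prog.always_pure ?_
      have hx : (0 : ℝ) < (1 + δ) * (Fintype.card V / 2 ^ i) := by positivity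
      simp only
      rw [← div_div]
      exact div_pos (hx.trans_le h) (by linarith)
    · exact ih _ _

theorem estimateOPT_bounds (G : Network V) (Sr : Finset V) (k : ℕ) (N δ : ℝ) (hN : 0 < N)
    (hδ : 0 < δ) (hn : 2 ≤ Fintype.card V) (hm : Fintype.card V ≤ G.edges.card) (hk : 1 ≤ k)
    (hkn : k ≤ Fintype.card V) :
    (estimateOPT G Sr k N δ).expectedTime ≤ ENNReal.ofReal (k + 1 +
      (196 + 84 * ((2 + δ) / δ ^ 2 * (2 * N + 2)) * (3 * tailConst N δ)) *
        (k * G.edges.card * Real.log (Fintype.card V))) ∧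
    ((estimateOPT G Sr k N δ).mean fun y => ENNReal.ofReal y.1⁻¹) ≤
      ENNReal.ofReal (3 * tailConst N δ / max (OPT G Sr 1) 1) := by
  set n := Fintype.card V with hndef
  set m := G.edges.card
  set O := max (OPT G Sr 1) 1 with hO
  set L := Nat.log 2 (n - 1) with hLdef
  set p := OPT G Sr 1 / n
  set b := failBound n k N δ p with hb
  have hn0 : (0 : ℝ) < n := by positivity
  have hO1 : 1 ≤ O := le_max_right _ _
  have hO0 : 0 < O := by linarith
  have hOn : O ≤ n := max_le (OPT_le_card G Sr 1) (by exact_mod_cast (by omega : 1 ≤ n))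
  have hmn : (n : ℝ) ≤ m := by exact_mod_cast hm
  have hk1 : (1 : ℝ) ≤ k := by exact_mod_cast hk
  have hlog := half_le_log hn
  have hL1 : 2 ^ L ≤ n := (Nat.pow_log_le_self 2 (by omega)).trans (Nat.sub_le n 1)
  have hL2 : n ≤ 2 ^ (0 + L + 1) := by
    have : n - 1 < 2 ^ (L + 1) := Nat.lt_pow_succ_log_self one_lt_two (n - 1)
    rw [zero_add]
    omega
  have hb0 : ∀ r, 0 ≤ b r := failBound_nonneg n k N δ p
  have hb1 : ∀ r, b r ≤ 1 := failBound_le_one n k N δ p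
  have hZ := sum_failBound_le (k := k) hN hδ hn hkn (OPT_le_card G Sr 1) hL1
  rw [← hO] at hZ
  change ∑ r ∈ Finset.range (L + 1), b r * (O * 2 ^ (r + 1) / n) ≤ _ at hZ
  -- The fictitious round 0 fails surely on the empty collection, which turns the bounds conditional
  -- on a failed round into bounds for the whole loop.
  have hstart : ∀ (h : List (RTuple V) → ℝ≥0∞),
      ((generate G Sr (roundSize n k N δ 0) []).mean fun y => failInd k N δ 0 y.1 * h y.1) =
        h [] := by
    intro h
    have : roundSize n k N δ 0 = 0 := by simp [roundSize]
    rw [this, generate, Prog.mean_pure, failInd,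
      if_pos (show RoundFails V k N δ 0 _ from Or.inl rfl), one_mul]
  constructor
  · have h1 := estimateLoop_expectedTime_le G Sr k N δ hkn (by omega) (fun i => ENNReal.ofReal (b i))
      (fun i X Y => failInd_mean_le G Sr k N δ hk i X Y) L 0
    rw [hstart fun R => (estimateLoop G Sr k N δ L (0 + 1) R).expectedTime] at h1
    rw [estimateOPT, Prog.expectedTime_tick_bind, ENNReal.ofReal_add (by positivity) (by
      have : 0 ≤ tailConst N δ := by rw [tailConst]; positivity
      have : 0 ≤ Real.log n := by linarith
      positivity)]
    refine add_le_add (le_of_eq ?_) (h1.trans ?_)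
    · rw [← Nat.cast_add_one, ENNReal.ofReal_natCast]
    set A := 3 * (m / n * O) with hA
    have hA0 : 0 ≤ A := by positivity
    set Λ := max (lam n k N δ) 0 with hΛ
    have hΛ0 : 0 ≤ Λ := le_max_right _ _
    calc _ ≤ ∑ r ∈ Finset.range L, ENNReal.ofReal
          (b r * (14 * (n + 2 * roundSize n k N δ (r + 1) * A))) := by
          refine Finset.sum_le_sum fun r _ => ?_
          rw [ENNReal.ofReal_mul (hb0 r), ENNReal.ofReal_mul (by norm_num),
            ENNReal.ofReal_add (by positivity) (by positivity),
            ENNReal.ofReal_mul (by positivity), ENNReal.ofReal_mul (by norm_num),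
            ENNReal.ofReal_natCast, ENNReal.ofReal_natCast, zero_add]
          have := meanSize_le G Sr hm
          simp only [ENNReal.ofReal_ofNat]
          gcongr
      _ = ENNReal.ofReal (∑ r ∈ Finset.range L,
          b r * (14 * (n + 2 * roundSize n k N δ (r + 1) * A))) := by
          rw [ENNReal.ofReal_sum_of_nonneg]
          intro r _
          have := hb0 r
          positivity
      _ ≤ _ := by
          refine ENNReal.ofReal_le_ofReal ?_
          -- The excess 1 in the round size goes with the per-round overhead. The rest is (m/n)Λ
          -- times the summand controlled by `sum_failBound_le`, with 84 = 14·2·3.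
          have hterm : ∀ r ∈ Finset.range L,
              b r * (14 * (n + 2 * roundSize n k N δ (r + 1) * A)) ≤
                14 * (n + 2 * A) + 84 * (m / n) * Λ * (b r * (O * 2 ^ (r + 1) / n)) := by
            intro r _
            have h2 := roundSize_le n k N δ (r + 1)
            rw [← hΛ] at h2
            calc b r * (14 * (n + 2 * roundSize n k N δ (r + 1) * A))
                ≤ b r * (14 * (n + 2 * (Λ * 2 ^ (r + 1) / n + 1) * A)) := by
                  have := hb0 r
                  gcongr
              _ = b r * (14 * (n + 2 * A)) +
                  84 * (m / n) * Λ * (b r * (O * 2 ^ (r + 1) / n)) := by rw [hA]; ring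
              _ ≤ _ := add_le_add_left (mul_le_of_le_one_left (by positivity) (hb1 r)) _
          refine (Finset.sum_le_sum hterm).trans ?_
          rw [Finset.sum_add_distrib, Finset.sum_const, Finset.card_range, nsmul_eq_mul,
            ← Finset.mul_sum]
          have hZ' : ∑ r ∈ Finset.range L, b r * (O * 2 ^ (r + 1) / n) ≤ 3 * tailConst N δ := by
            refine le_trans ?_ hZ
            rw [Finset.sum_range_succ]
            have := hb0 L
            exact le_add_of_nonneg_right (by positivity)
          have hA' : A ≤ 3 * m := by
            rw [hA]
            have : (m : ℝ) / n * O ≤ m / n * n := by gcongr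
            rw [div_mul_cancel₀ _ hn0.ne'] at this
            linarith
          have hLlog : (L : ℝ) ≤ 2 * Real.log n := by
            have h2 : Real.log ((2 : ℝ) ^ L) ≤ Real.log n :=
              Real.log_le_log (by positivity) (by exact_mod_cast hL1)
            rw [Real.log_pow] at h2
            have h3 : (L : ℝ) * (1 / 2) ≤ L * Real.log 2 := by
              gcongr
              linarith [Real.log_two_gt_d9]
            linarith
          have hK : 0 ≤ (2 + δ) / δ ^ 2 * (2 * N + 2) := by positivity
          have hΛ' : Λ ≤ (2 + δ) / δ ^ 2 * (2 * N + 2) * (n * (k * Real.log n)) := by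
            refine max_le (lam_le hN hδ hn hk hkn) ?_
            have : 0 ≤ Real.log n := by linarith
            positivity
          -- Overhead O(m) in each of at most 2 ln n rounds: 196 = 2·14·7.
          have hfirst : (L : ℝ) * (14 * (n + 2 * A)) ≤ 196 * (k * m * Real.log n) := by
            calc (L : ℝ) * (14 * (n + 2 * A)) ≤ (2 * Real.log n) * (14 * (m + 2 * (3 * m))) := by
                  gcongr
              _ = 1 * (196 * (m * Real.log n)) := by ring
              _ ≤ k * (196 * (m * Real.log n)) := by
                  have : 0 ≤ Real.log n := by linarith
                  gcongr
              _ = _ := by ring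
          have hT : 0 ≤ 3 * tailConst N δ := by rw [tailConst]; positivity
          have hsecond : 84 * (m / n : ℝ) * Λ *
              ∑ r ∈ Finset.range L, b r * (O * 2 ^ (r + 1) / n) ≤
              84 * ((2 + δ) / δ ^ 2 * (2 * N + 2)) * (3 * tailConst N δ) *
                (k * m * Real.log n) := by
            calc _ ≤ 84 * (m / n : ℝ) * ((2 + δ) / δ ^ 2 * (2 * N + 2) * (n * (k * Real.log n))) *
                  (3 * tailConst N δ) := by
                  gcongr
                  exact Finset.sum_nonneg fun r _ => mul_nonneg (hb0 r) (by positivity)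
              _ = _ := by field_simp
          linarith
  · have h1 := estimateLoop_mean_inv_le G Sr k N δ hδ (fun i => ENNReal.ofReal (b i))
      (fun i => by simpa using failInd_mean_le G Sr k N δ hk i 1 0) L 0 hL2
    rw [hstart fun R => (estimateLoop G Sr k N δ L (0 + 1) R).mean fun z =>
      ENNReal.ofReal z.1⁻¹] at h1
    rw [estimateOPT, Prog.mean_bind, Prog.mean_tick]
    refine h1.trans ?_
    calc _ = ENNReal.ofReal (∑ r ∈ Finset.range (L + 1), b r * (2 ^ (r + 1) / n)) := by
          rw [ENNReal.ofReal_sum_of_nonneg]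
          · refine Finset.sum_congr rfl fun r _ => ?_
            rw [ENNReal.ofReal_mul (hb0 r), zero_add]
          · intro r _
            have := hb0 r
            positivity
      _ ≤ _ := by
          refine ENNReal.ofReal_le_ofReal ?_
          rw [le_div_iff₀ hO0, Finset.sum_mul]
          refine le_trans (le_of_eq (Finset.sum_congr rfl fun r _ => ?_)) hZ
          ring

theorem estimateOPT_always_pos (G : Network V) (Sr : Finset V) (k : ℕ) (N δ : ℝ) (hδ : 0 < δ) :
    (estimateOPT G Sr k N δ).Always fun y => 0 < y.1 := by
  rw [estimateOPT]
  exact Prog.always_tick_bind (estimateLoop_always_pos G Sr k N δ hδ _ _ _)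

theorem generate_select_expectedTime_le (G : Network V) (Sr : Finset V) (k j : ℕ) :
    (generate G Sr j [] >>= fun R =>
      det (nodeSelection (Finset.univ : Finset V).toList R k)).expectedTime ≤
      3 * Fintype.card V + 2 + 13 * (j * meanSize G Sr) := by
  rw [Prog.expectedTime_bind]
  calc _ ≤ (generate G Sr j []).mean fun y =>
        (3 * Fintype.card V + 2 : ℝ≥0∞) + 13 * totalSize G y.1 := by
        refine Prog.mean_mono ((generate_always G Sr j [] (by simp)).mono ?_)
        rintro ⟨R, t⟩ ⟨-, -, h3⟩
        have h4 := nodeSelection_cost G R k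
        rw [Prog.expectedTime_det]
        simp only [totalSize_nil] at h3 ⊢
        norm_cast
        omega
    _ = _ := by
        rw [Prog.mean_add, Prog.mean_const, Prog.mean_const_mul, generate_mean_totalSize]
        simp

theorem rbr_expectedTime_le {N δ₃ c : ℝ} (hN : 0 < N) (hδ : 0 < δ₃) (hc : 0 < c) (G : Network V)
    (Sr : Finset V) {k : ℕ} {δ₁ δ₂ : ℝ} (hn : 2 ≤ Fintype.card V)
    (hm : Fintype.card V ≤ G.edges.card) (hk : 1 ≤ k) (hkn : k ≤ Fintype.card V) (h0 : 0 < δ₂)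
    (h1 : δ₂ ≤ 1) (hδ₁ : c * δ₂ ≤ δ₁) (hδ₂ : c * δ₂ ≤ δ₂ - (1 - Real.exp (-1)) * δ₁) :
    (rbr G Sr k N δ₁ δ₂ δ₃).expectedTime ≤ ENNReal.ofReal
      ((300 + (84 * ((2 + δ₃) / δ₃ ^ 2 * (2 * N + 2)) + 39 * ((10 * N + 3) / c ^ 2)) *
        (3 * tailConst N δ₃)) * (k * G.edges.card * Real.log (Fintype.card V)) / δ₂ ^ 2) := by
  obtain ⟨hT, hI⟩ := estimateOPT_bounds G Sr k N δ₃ hN hδ hn hm hk hkn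
  set n := Fintype.card V with hndef
  set m := G.edges.card
  set O := max (OPT G Sr 1) 1 with hO
  set Z := 3 * tailConst N δ₃ with hZ
  set K₁ := (2 + δ₃) / δ₃ ^ 2 * (2 * N + 2) with hK₁
  set K₂ := (10 * N + 3) / c ^ 2 with hK₂
  have hK₁0 : 0 ≤ K₁ := by positivity
  have hK₂0 : 0 ≤ K₂ := by positivity
  have hZ0 : 0 ≤ Z := by rw [hZ, tailConst]; positivity
  have hn0 : (0 : ℝ) < n := by positivity
  have hO1 : 1 ≤ O := le_max_right _ _
  have hO0 : 0 < O := by linarith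
  have hOn : O ≤ n := max_le (OPT_le_card G Sr 1) (by exact_mod_cast (by omega : 1 ≤ n))
  have hmn : (n : ℝ) ≤ m := by exact_mod_cast hm
  have hk1 : (1 : ℝ) ≤ k := by exact_mod_cast hk
  have hkn' : (k : ℝ) ≤ n := by exact_mod_cast hkn
  have hlog := half_le_log hn
  have hlog0 : 0 ≤ Real.log n := by linarith
  set D := K₂ * (n * (k * Real.log n)) / δ₂ ^ 2 with hD
  have hD0 : 0 ≤ D := by positivity
  set A := 3 * (m / n * O) with hA
  have hA0 : 0 ≤ A := by positivity
  -- The second phase uses fresh R-tuples, so its cost for a given estimate x is a mean over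
  -- independent samples. It is affine in 1/x, so E[1/x] suffices.
  have hrest : ∀ x : ℝ, 0 < x → (tick (k + 1) >>= fun _ =>
      generate G Sr ⌈lStar n k N δ₁ δ₂ x⌉₊ [] >>= fun R =>
        det (nodeSelection (Finset.univ : Finset V).toList R k)).expectedTime ≤
      ENNReal.ofReal (k + 1 + 3 * n + 2 + 13 * A) +
        ENNReal.ofReal (13 * A * D) * ENNReal.ofReal x⁻¹ := by
    intro x hx
    rw [Prog.expectedTime_tick_bind]
    have hx' : 0 < x⁻¹ := inv_pos.2 hx
    have hJ : (⌈lStar n k N δ₁ δ₂ x⌉₊ : ℝ) ≤ D * x⁻¹ + 1 := by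
      have hl := lStar_le hN hc hn hk hkn hx h0 h1 hδ₁ hδ₂
      refine (Nat.cast_le.2 (Nat.ceil_mono hl)).trans ?_
      exact (Nat.ceil_lt_add_one (by positivity)).le
    refine (add_le_add_right (generate_select_expectedTime_le G Sr k _) _).trans ?_
    rw [← ENNReal.ofReal_mul (by positivity), ← ENNReal.ofReal_add (by positivity) (by positivity)]
    generalize ⌈lStar n k N δ₁ δ₂ x⌉₊ = J at *
    calc _ ≤ ((k + 1 : ℕ) : ℝ≥0∞) + (3 * n + 2 + 13 * (J * ENNReal.ofReal A)) := by
          have := meanSize_le G Sr hm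
          gcongr
      _ = ENNReal.ofReal (k + 1 + (3 * n + 2 + 13 * (J * A))) := by
          rw [show (k + 1 + (3 * n + 2 + 13 * (J * A)) : ℝ) =
            ((k + 1 + (3 * n + 2) : ℕ) : ℝ) + 13 * (J * A) by push_cast; ring,
            ENNReal.ofReal_add (Nat.cast_nonneg _) (by positivity), ENNReal.ofReal_natCast,
            ENNReal.ofReal_mul (p := 13) (by positivity),
            ENNReal.ofReal_mul (p := (J : ℝ)) (by positivity), ENNReal.ofReal_natCast,
            ENNReal.ofReal_ofNat]
          push_cast
          ring
      _ ≤ _ := by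
          refine ENNReal.ofReal_le_ofReal ?_
          have : 13 * (J * A) ≤ 13 * ((D * x⁻¹ + 1) * A) := by gcongr
          linarith
  rw [rbr, Prog.expectedTime_tick_bind, Prog.expectedTime_bind]
  calc _ ≤ ((n + m : ℕ) : ℝ≥0∞) + (estimateOPT G Sr k N δ₃).mean fun y => (y.2 : ℝ≥0∞) +
        (ENNReal.ofReal (k + 1 + 3 * n + 2 + 13 * A) +
          ENNReal.ofReal (13 * A * D) * ENNReal.ofReal y.1⁻¹) := by
        refine add_le_add_right (Prog.mean_mono ?_) _
        exact (estimateOPT_always_pos G Sr k N δ₃ hδ).mono fun y hy =>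
          add_le_add_right (hrest y.1 hy) _
    _ = ((n + m : ℕ) : ℝ≥0∞) + ((estimateOPT G Sr k N δ₃).expectedTime +
        (ENNReal.ofReal (k + 1 + 3 * n + 2 + 13 * A) + ENNReal.ofReal (13 * A * D) *
          (estimateOPT G Sr k N δ₃).mean fun y => ENNReal.ofReal y.1⁻¹)) := by
        rw [Prog.mean_add, Prog.mean_add, Prog.mean_const, Prog.mean_const_mul,
          Prog.expectedTime_eq_mean]
    _ ≤ ENNReal.ofReal (n + m) + (ENNReal.ofReal
          (k + 1 + (196 + 84 * K₁ * Z) * (k * m * Real.log n)) +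
        (ENNReal.ofReal (k + 1 + 3 * n + 2 + 13 * A) + ENNReal.ofReal (13 * A * D) *
          ENNReal.ofReal (Z / O))) := by
        have e : ((n + m : ℕ) : ℝ≥0∞) = ENNReal.ofReal (n + m) := by
          rw [← Nat.cast_add, ENNReal.ofReal_natCast]
        rw [e]
        gcongr
    _ = ENNReal.ofReal (n + m + (k + 1 + (196 + 84 * K₁ * Z) * (k * m * Real.log n) +
        (k + 1 + 3 * n + 2 + 13 * A + 13 * A * D * (Z / O)))) := by
        rw [← ENNReal.ofReal_mul (by positivity), ← ENNReal.ofReal_add (by positivity)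
          (by positivity), ← ENNReal.ofReal_add (by positivity) (by positivity),
          ← ENNReal.ofReal_add (by positivity) (by positivity)]
    _ ≤ _ := by
        refine ENNReal.ofReal_le_ofReal ?_
        set Q := k * m * Real.log n / δ₂ ^ 2 with hQ
        have hd2 : 0 < δ₂ ^ 2 := by positivity
        have hm0 : (0 : ℝ) ≤ m := by positivity
        have hq : k * m * Real.log n ≤ Q := by
          rw [hQ, le_div_iff₀ hd2]
          exact mul_le_of_le_one_right (by positivity) (pow_le_one₀ h0.le h1)
        have hmQ : m ≤ 2 * Q := by
          have : 1 * m * (1 / 2) ≤ k * m * Real.log n := by gcongr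
          linarith
        have hA' : A ≤ 3 * m := by
          rw [hA]
          have : (m : ℝ) / n * O ≤ m / n * n := by gcongr
          rw [div_mul_cancel₀ _ hn0.ne'] at this
          linarith
        -- Here O from the mean size of an R-tuple cancels 1/O from the expected inverse estimate.
        have hlast : 13 * A * D * (Z / O) = 39 * K₂ * Z * Q := by
          rw [hA, hD, hQ]
          field_simp
          ring
        have hmid : (196 + 84 * K₁ * Z) * (k * m * Real.log n) ≤ (196 + 84 * K₁ * Z) * Q := by
          gcongr
        have hgoal : (300 + (84 * K₁ + 39 * K₂) * Z) * (k * m * Real.log n) / δ₂ ^ 2 =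
            (196 + 84 * K₁ * Z) * Q + 39 * K₂ * Z * Q + 104 * Q := by
          rw [hQ]; ring
        rw [hgoal, hlast]
        linarith

end

end RBR

theorem mainTheorem4 :
    (∀ (V : Type) [Fintype V] [DecidableEq V] [Nonempty V]
      (G : RBR.Network V) (Sr : Finset V),
      (RBR.randomRTuple G Sr).expect RBR.RTuple.numTested ≤
        ENNReal.ofReal ((G.edges.card : ℝ) / (Fintype.card V : ℝ) * RBR.OPT G Sr 1)) ∧
    (∀ N δ₃ c : ℝ, 0 < N → 0 < δ₃ → 0 < c →
      ∃ C : ℝ, 0 < C ∧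
        ∀ (V : Type) [Fintype V] [DecidableEq V] [Nonempty V]
          (G : RBR.Network V) (Sr : Finset V) (k : ℕ) (δ₁ δ₂ : ℝ),
          2 ≤ Fintype.card V →
          Fintype.card V ≤ G.edges.card →
          1 ≤ k → k ≤ Fintype.card V →
          0 < δ₂ → δ₂ ≤ 1 →
          c * δ₂ ≤ δ₁ →
          c * δ₂ ≤ δ₂ - (1 - Real.exp (-1)) * δ₁ →
          (RBR.rbr G Sr k N δ₁ δ₂ δ₃).expectedTime ≤
            ENNReal.ofReal
              (C * (k * G.edges.card * Real.log (Fintype.card V)) / δ₂ ^ 2)) := by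
  refine ⟨fun V _ _ _ G Sr => RBR.expect_numTested_le G Sr, fun N δ₃ c hN hδ hc => ?_⟩
  -- 300 is 196 from the overhead of the rounds plus 104 for all terms linear in m, and 39 = 13·3
  -- comes from the second phase.
  refine ⟨300 + (84 * ((2 + δ₃) / δ₃ ^ 2 * (2 * N + 2)) + 39 * ((10 * N + 3) / c ^ 2)) *
    (3 * RBR.tailConst N δ₃), ?_, ?_⟩
  · rw [RBR.tailConst]; positivity
  · intro V _ _ _ G Sr k δ₁ δ₂ hn hm hk hkn h0 h1 hδ₁ hδ₂
    exact RBR.rbr_expectedTime_le hN hδ hc G Sr hn hm hk hkn h0 h1 hδ₁ hδ₂
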